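/- Let $f:\mathbb R^2\to\mathbb R$ be continuously differentiable and $\sigma>0$, and consider the stochastic differential equation \[ \mathrm dx=f(t,x)\,\mathrm dt+\sigma\,\mathrm dW_t ,\qquad t,x\in\mathbb R, \] where the noise is modelled on the Wiener space $\Omega=C_0(\mathbb R,\mathbb R)=\{\omega\in C(\mathbb R,\mathbb R):\omega(0)=0\}$ with the compact-open topology, its Borel $\sigma$-algebra $\mathcal F$, the (two-sided) Wiener measure $\mathbb P$, $W_t(\omega)=\omega(t)$, and the Wiener shift $\theta_t\omega=\omega(\cdot+t)-\omega(t)$. Let $\mathcal X(t,\tau,\omega,x)$ be the value at time $t$ of the pathwise solution of the equation with initial condition $x$ at time $\tau$ (whenever this solution exists between the times $\tau$ and $t$), and let $\Phi$ be given by $\Phi(t,\tau,\theta_\tau\omega,x)=\mathcal X(t+\tau,\tau,\omega,x)$. Write $\Phi(t,\tau,\omega)x=\Phi(t,\tau,\omega,x)$. Assume: 1. (Dissipativity) there are constants $L_1\ge 0$ and $L_2>0$ such that $(x_1-x_2)\bigl(f(t,x_1)-f(t,x_2)\bigr)\le L_1-L_2|x_1-x_2|^2$ for all $t,x_1,x_2\in\mathbb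 R$; 2. (Integrability) there is $C_0>0$ such that $\int_{-\infty}^t e^{cr}|f(r,u(r))|^2\,\mathrm dr<\infty$ for all $t\in\mathbb R$, all $0<c<C_0$ and all continuous $u:\mathbb R\to\mathbb R$ with sub-exponential growth (that is, $u(r)e^{-\varepsilon|r|}\to0$ as $|r|\to\infty$ for every $\varepsilon>0$). Then $(\theta,\Phi)$ is a nonautonomous random dynamical system: $\theta$ is a measurable, measure preserving flow on $(\Omega,\mathcal F,\mathbb P)$; $\Phi(t,\tau,\omega)x$ is defined for all $t\ge0$, $\tau\in\mathbb R$, $\omega\in\Omega$, $x\in\mathbb R$ (and for $t<0$ as long as the solution does not explode backwards in time); $\Phi$ is measurable on its domain, which is a measurable set; and for almost all $\omega$, $\Phi(\cdot,\cdot,\omega,\cdot)$ is continuous on its domain, which is open, $\Phi(0,\tau,\omega)x=x$ for all $\tau,x$, and $\Phi(t+s,\tau,\omega)x=\Phi(t,\tau+s,\theta_s\omega)\Phi(s,\tau,\omega)x$ for all $t,s,\tau,x$ for which $\Phi(s,\tau,\omega)x$ is defined (one side being defined if and only if the other is). Moreover, $(\theta,\Phi)$ has a global nonautonomous random attractor: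 there is a $\mathcal B(\mathbb R)\otimes\mathcal F\otimes\mathcal B(\mathbb R)$-measurable set $A\subset\mathbb R\times\Omega\times\mathbb R$ whose fibers $A(\tau,\omega)=\{x:(\tau,\omega,x)\in A\}$ are all compact, such that for almost all $\omega\in\Omega$ - (invariance) for all $t,\tau\in\mathbb R$, $\Phi(t,\tau,\omega)$ is defined on $A(\tau,\omega)$ and $\Phi(t,\tau,\omega)A(\tau,\omega)=A(\tau+t,\theta_t\omega)$; - (attraction) for all $\tau\in\mathbb R$ and all bounded sets $C\subset\mathbb R$, $\lim_{t\to\infty}\operatorname{dist}\bigl(\Phi(t,\tau-t,\theta_{-t}\omega)C,\,A(\tau,\omega)\bigr)=0$, where $\operatorname{dist}(D_1,D_2)=\sup_{x\in D_1}\inf_{y\in D_2}|x-y|$ (with $\inf\emptyset=\infty$, so that $A(\tau,\omega)\neq\emptyset$). -/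

import Mathlib

open MeasureTheory ProbabilityTheory Filter Topology Set

noncomputable section

/-! ### Nonautonomous random dynamical systems on a metric space `X`, with time set `ℝ` -/

/-- A measure preserving (metric) measurable dynamical system with time set `ℝ`. -/
structure IsMetricDS {Ω : Type*} [MeasurableSpace Ω] (P : Measure Ω) (θ : ℝ → Ω → Ω) : Prop where
  measurable : Measurable (fun p : ℝ × Ω => θ p.1 p.2)
  zero : ∀ ω, θ 0 ω = ω
  add : ∀ t s ω, θ (t + s) ω = θ t (θ s ω)
  measurePreserving : ∀ t, MeasurePreserving (θ t) P P

/-- `(θ, Φ)` is a nonautonomous random dynamical system on `X`. The map `Φ t τ ω` sends the state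
at time `τ` to the state at time `τ + t`. It is defined on all of `X` for elapsed times `t ≥ 0`;
for `t < 0` it may be a partial map, since solutions of a differential equation can explode
backwards in time (as they do for a cubic damping). If every `Φ t τ ω` is total, the conditions
below are the usual ones for a two-sided cocycle.

`measurable` and `continuous` say that `Φ` is measurable on its domain, which is a measurable set,
and that for almost every `ω` it is continuous on its domain, which is an open set
(recall `p.preimage U = {x | ∃ y ∈ U, y ∈ p x}` for a partial map `p`). -/
structure IsNRDS {Ω X : Type*} [MeasurableSpace Ω] [MetricSpace X] [MeasurableSpace X]
    (P : Measure Ω) (θ : ℝ → Ω → Ω) (Φ : ℝ → ℝ → Ω → X →. X) : Prop where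
  base : IsMetricDS P θ
  forward : ∀ t τ ω, 0 ≤ t → (Φ t τ ω).Dom = Set.univ
  measurable : ∀ B : Set X, MeasurableSet B →
    MeasurableSet {p : ℝ × ℝ × Ω × X | p.2.2.2 ∈ (Φ p.1 p.2.1 p.2.2.1).preimage B}
  zero : ∀ᵐ ω ∂P, ∀ τ x, Φ 0 τ ω x = Part.some x
  cocycle : ∀ᵐ ω ∂P, ∀ t s τ x y, y ∈ Φ s τ ω x →
    Φ (t + s) τ ω x = Φ t (τ + s) (θ s ω) y
  continuous : ∀ᵐ ω ∂P, ∀ U : Set X, IsOpen U →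
    IsOpen {p : ℝ × ℝ × X | p.2.2 ∈ (Φ p.1 p.2.1 ω).preimage U}

/-- The `(τ, ω)`-fiber of a subset of `ℝ × Ω × X`. -/
def nrFiber {Ω X : Type*} (M : Set (ℝ × Ω × X)) (τ : ℝ) (ω : Ω) : Set X :=
  {x | (τ, ω, x) ∈ M}

/-- The Hausdorff semi-distance `sup_{x ∈ D₁} inf_{y ∈ D₂} d(x, y)`, with values in `[0, ∞]`. -/
def hausdorffSemiDist {X : Type*} [MetricSpace X] (D₁ D₂ : Set X) : ENNReal :=
  ⨆ x ∈ D₁, ⨅ y ∈ D₂, edist x y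

/-- `A` is a global nonautonomous random attractor of `(θ, Φ)`: a compact invariant
nonautonomous random set that attracts all bounded deterministic sets in the pullback sense. -/
structure IsGlobalNRAttractor {Ω X : Type*} [MeasurableSpace Ω] [MetricSpace X]
    [MeasurableSpace X] (P : Measure Ω) (θ : ℝ → Ω → Ω) (Φ : ℝ → ℝ → Ω → X →. X)
    (A : Set (ℝ × Ω × X)) : Prop where
  measurableSet : MeasurableSet A
  compact : ∀ τ ω, IsCompact (nrFiber A τ ω)
  invariant : ∀ᵐ ω ∂P, ∀ t τ : ℝ, nrFiber A τ ω ⊆ (Φ t τ ω).Dom ∧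
    (Φ t τ ω).image (nrFiber A τ ω) = nrFiber A (τ + t) (θ t ω)
  attracting : ∀ᵐ ω ∂P, ∀ (τ : ℝ) (C : Set X), Bornology.IsBounded C →
    Tendsto (fun t : ℝ => hausdorffSemiDist ((Φ t (τ - t) (θ (-t) ω)).image C) (nrFiber A τ ω))
      atTop (𝓝 0)

/-! ### The two-sided Wiener space -/

/-- `C₀(ℝ, ℝ)`, the continuous paths that vanish at `0`, with the compact-open topology. -/
abbrev WienerSpace : Type := {ω : C(ℝ, ℝ) // ω 0 = 0}

/-- The Borel σ-algebra of the compact-open topology. -/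
instance instMeasurableSpaceWienerSpace : MeasurableSpace WienerSpace := borel WienerSpace

/-- The Wiener shift `θ_t ω = ω(· + t) - ω(t)`. -/
def wienerShift (t : ℝ) (ω : WienerSpace) : WienerSpace :=
  ⟨⟨fun s => ω.1 (s + t) - ω.1 t, by fun_prop⟩, by simp⟩

/-- `P` is the Wiener measure on `C₀(ℝ, ℝ)`: under `P` the coordinate process `(ω(t))_{t ∈ ℝ}` has
independent increments, and its increment over `[s, t]` is centered Gaussian with
variance `t - s`. -/
structure IsWienerMeasure (P : Measure WienerSpace) : Prop where
  isProbabilityMeasure : IsProbabilityMeasure P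
  indep : HasIndepIncrements (fun (t : ℝ) (ω : WienerSpace) => ω.1 t) P
  gaussian : ∀ s t : ℝ, s ≤ t →
    P.map (fun ω : WienerSpace => ω.1 t - ω.1 s) = gaussianReal 0 (Real.toNNReal (t - s))

/-! ### The stochastic differential equation `dx = f(t, x) dt + σ dW_t` -/

/-- `u` is a pathwise solution on the interval `I ∋ τ` of `dx = f(t, x) dt + σ dW_t`, `x(τ) = x`,
for the noise realization `ω`. -/
def IsPathwiseSolution (f : ℝ → ℝ → ℝ) (σ : ℝ) (ω : WienerSpace) (τ x : ℝ) (I : Set ℝ)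
    (u : ℝ → ℝ) : Prop :=
  ContinuousOn u I ∧
    ∀ s ∈ I, u s = x + (∫ r in τ..s, f r (u r)) + σ * (ω.1 s - ω.1 τ)

/-- The stochastic flow `𝒳(t, τ, ω, x)`: the value at time `t` of the pathwise solution that starts
in `x` at time `τ`, defined whenever this solution exists between the times `τ` and `t`.
(For `f` continuously differentiable the solution is unique.) -/
def sdeFlow (f : ℝ → ℝ → ℝ) (σ t τ : ℝ) (ω : WienerSpace) : ℝ →. ℝ := fun x =>
  ⟨∃ u, IsPathwiseSolution f σ ω τ x (Set.uIcc τ t) u, fun h => h.choose t⟩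

/-- The cocycle `Φ(t, τ, θ_τ ω, x) = 𝒳(t + τ, τ, ω, x)` generated by the equation. -/
def sdeCocycle (f : ℝ → ℝ → ℝ) (σ t τ : ℝ) (ω : WienerSpace) : ℝ →. ℝ :=
  sdeFlow f σ (t + τ) τ (wienerShift (-τ) ω)

/-! ### The conditions on the drift -/

/-- The dissipativity condition. -/
def IsDissipative (f : ℝ → ℝ → ℝ) : Prop :=
  ∃ L₁ L₂ : ℝ, 0 ≤ L₁ ∧ 0 < L₂ ∧ ∀ t x₁ x₂ : ℝ,
    (x₁ - x₂) * (f t x₁ - f t x₂) ≤ L₁ - L₂ * |x₁ - x₂| ^ 2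

/-- Sub-exponential growth: `u(t) e^{-ε|t|} → 0` as `|t| → ∞`, for every `ε > 0`. -/
def HasSubexponentialGrowth (u : ℝ → ℝ) : Prop :=
  ∀ ε : ℝ, 0 < ε →
    Tendsto (fun t => u t * Real.exp (-ε * |t|)) (atBot ⊔ atTop) (𝓝 0)

/-- The integrability condition. -/
def IsExpIntegrable (f : ℝ → ℝ → ℝ) : Prop :=
  ∃ C₀ : ℝ, 0 < C₀ ∧ ∀ (t c : ℝ), 0 < c → c < C₀ →
    ∀ u : ℝ → ℝ, Continuous u → HasSubexponentialGrowth u →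
      IntegrableOn (fun r => Real.exp (c * r) * |f r (u r)| ^ 2) (Set.Iic t)

end

/-! ### Scalar differential equations with a globally Lipschitz right-hand side -/

/-! The noise is additive, so `y = x - σ ω` turns the equation into the random ODE `y' = f (τ + h)
(y + σ ω h)` in the elapsed time `h`; the shift in the cocycle makes `ω` itself, based at `0`, the
driving path. Clamping the drift to a square of radius `R` gives a globally Lipschitz, bounded
field, whose solution exists for all time and is jointly continuous in time, `τ`, `ω` and `x` by
Grönwall (`continuous_truncPath`). A value of the cocycle is a value of a truncated solution that
has stayed in the open square for some `R` (`mem_sdeCocycle_iff`). The preimages are therefore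
countable unions over `R` of simple sets, which yields measurability, open domains, continuity and
the cocycle law, for every `ω`.

Dissipativity applied to `y + σ ω` and `σ ω`, with Young's inequality, bounds the derivative of `exp
(c h) y²` by `exp (c h) (2 L₁ + |f (τ + h) (σ ω h)|² / L₂)` whenever `c ≤ L₂`. This excludes forward
explosion (`exists_mem_sdeCocycle_of_nonneg`). If also `0 < c < C₀` and `ω` grows subexponentially,
the bound is integrable at `-∞`. Almost every path grows at most cubically, by a sixth-moment
chaining argument (`IsWienerMeasure.ae_hasCubicGrowth`).

The integral of the bound up to time `s` then gives the radius of a pullback absorbing ball at time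
`s`. The states carried out of that ball by the flow from `s ≤ 0` to `0` form compact sets
decreasing as `s → -∞`, and the attractor is their intersection. Attraction follows from absorption
and compactness. Invariance follows because the fibers consist of the points on entire trajectories
with `exp (c h) v² → 0` at `-∞` (`mem_attractorFiber_iff`), a class stable under time shifts. -/

theorem abs_sub_le_gronwallBound_of_nonneg {g : ℝ → ℝ → ℝ} {K : NNReal}
    (hg : ∀ h, LipschitzWith K (g h)) {y₁ y₂ y₂' : ℝ → ℝ} {t δ ε : ℝ} (ht : 0 ≤ t)
    (h₁ : ∀ h ∈ Icc 0 t, HasDerivAt y₁ (g h (y₁ h)) h)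
    (h₂ : ∀ h ∈ Icc 0 t, HasDerivAt y₂ (y₂' h) h)
    (hε : ∀ h ∈ Icc 0 t, |y₂' h - g h (y₂ h)| ≤ ε) (hδ : |y₁ 0 - y₂ 0| ≤ δ) :
    |y₁ t - y₂ t| ≤ gronwallBound δ K ε t := by
  have := dist_le_of_approx_trajectories_ODE (v := g) (K := K) (f := y₁) (g := y₂)
    (f' := fun h => g h (y₁ h)) (g' := y₂') (a := 0) (b := t) (εf := 0) (εg := ε) (δ := δ) hg
    (fun h hh => (h₁ h hh).continuousAt.continuousWithinAt)
    (fun h hh => (h₁ h (Ico_subset_Icc_self hh)).hasDerivWithinAt) (by simp)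
    (fun h hh => (h₂ h hh).continuousAt.continuousWithinAt)
    (fun h hh => (h₂ h (Ico_subset_Icc_self hh)).hasDerivWithinAt)
    (fun h hh => hε h (Ico_subset_Icc_self hh)) hδ t ⟨ht, le_rfl⟩
  simpa [Real.dist_eq] using this

/-- A two-sided Grönwall estimate for approximate solutions. -/
theorem abs_sub_le_gronwallBound {g : ℝ → ℝ → ℝ} {K : NNReal}
    (hg : ∀ h, LipschitzWith K (g h)) {y₁ y₂ y₂' : ℝ → ℝ} {t δ ε : ℝ}
    (h₁ : ∀ h ∈ uIcc 0 t, HasDerivAt y₁ (g h (y₁ h)) h)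
    (h₂ : ∀ h ∈ uIcc 0 t, HasDerivAt y₂ (y₂' h) h)
    (hε : ∀ h ∈ uIcc 0 t, |y₂' h - g h (y₂ h)| ≤ ε) (hδ : |y₁ 0 - y₂ 0| ≤ δ) :
    |y₁ t - y₂ t| ≤ gronwallBound δ K ε |t| := by
  rcases le_total 0 t with ht | ht
  · rw [uIcc_of_le ht] at *
    rw [abs_of_nonneg ht]
    exact abs_sub_le_gronwallBound_of_nonneg hg ht h₁ h₂ hε hδ
  · rw [uIcc_of_ge ht] at *
    rw [abs_of_nonpos ht]
    have hmem : ∀ h ∈ Icc 0 (-t), -h ∈ Icc t 0 := fun h hh => ⟨by linarith [hh.2], by linarith [hh.1]⟩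
    have := abs_sub_le_gronwallBound_of_nonneg (g := fun h y => -g (-h) y) (K := K)
      (y₁ := fun h => y₁ (-h)) (y₂ := fun h => y₂ (-h)) (y₂' := fun h => -y₂' (-h)) (t := -t)
      (δ := δ) (ε := ε) (fun h => (hg (-h)).neg) (by linarith)
      (fun h hh => by simpa [Function.comp_def] using (h₁ (-h) (hmem h hh)).scomp h (hasDerivAt_neg h))
      (fun h hh => by simpa [Function.comp_def] using (h₂ (-h) (hmem h hh)).scomp h (hasDerivAt_neg h))
      (fun h hh => by
        have := hε (-h) (hmem h hh)
        rw [abs_sub_comm] at this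
        convert this using 2
        ring)
      (by simpa using hδ)
    simpa using this

theorem eq_of_hasDerivAt_uIcc {g : ℝ → ℝ → ℝ} {K : NNReal}
    (hg : ∀ h, LipschitzWith K (g h)) {y₁ y₂ : ℝ → ℝ} {t : ℝ}
    (h₁ : ∀ h ∈ uIcc 0 t, HasDerivAt y₁ (g h (y₁ h)) h)
    (h₂ : ∀ h ∈ uIcc 0 t, HasDerivAt y₂ (g h (y₂ h)) h) (h₀ : y₁ 0 = y₂ 0) : y₁ t = y₂ t := by
  have := abs_sub_le_gronwallBound hg (δ := 0) (ε := 0) h₁ h₂ (by simp) (by simp [h₀])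
  rw [gronwallBound_ε0_δ0] at this
  exact sub_eq_zero.1 (abs_nonpos_iff.1 this)

/-- Since the field is bounded by `M`, a Picard–Lindelöf ball of radius `M * (n + 1)` serves the
whole interval of half-length `n + 1`; uniqueness glues the local solutions. -/
theorem exists_forall_hasDerivAt_of_lipschitz_bounded {g : ℝ → ℝ → ℝ} {K : NNReal}
    (hg : ∀ h, LipschitzWith K (g h)) (hc : ∀ y, Continuous fun h => g h y) {M : ℝ}
    (hM : ∀ h y, |g h y| ≤ M) (x : ℝ) :
    ∃ y : ℝ → ℝ, y 0 = x ∧ ∀ h, HasDerivAt y (g h (y h)) h := by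
  lift M to NNReal using (abs_nonneg _).trans (hM 0 0)
  have hloc : ∀ n : ℕ, ∃ y : ℝ → ℝ, y 0 = x ∧
      ∀ h ∈ Ioo (-(n + 1 : ℝ)) (n + 1), HasDerivAt y (g h (y h)) h := by
    intro n
    have hn : (0 : ℝ) < n + 1 := by positivity
    have hP : IsPicardLindelof g (tmin := -(n + 1 : ℝ)) (tmax := n + 1)
        ⟨0, by constructor <;> linarith⟩ x (M * (n + 1)) 0 M K :=
      { lipschitzOnWith := fun t _ => (hg t).lipschitzOnWith
        continuousOn := fun y _ => (hc y).continuousOn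
        norm_le := fun t _ y _ => hM t y
        mul_max_le := by simp }
    obtain ⟨y, hy0, hy⟩ := hP.exists_eq_forall_mem_Icc_hasDerivWithinAt₀
    exact ⟨y, hy0, fun h hh => (hy h (Ioo_subset_Icc_self hh)).hasDerivAt (Icc_mem_nhds hh.1 hh.2)⟩
  choose Y hY0 hY using hloc
  have hagree : ∀ (m n : ℕ) (h : ℝ), |h| < m + 1 → |h| < n + 1 → Y m h = Y n h := by
    intro m n h hm hn
    have hsub : ∀ k : ℕ, |h| < k + 1 → ∀ r ∈ uIcc 0 h, r ∈ Ioo (-(k + 1 : ℝ)) (k + 1) := by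
      intro k hk r hr
      refine abs_lt.1 ?_
      have := abs_sub_left_of_mem_uIcc hr
      simp only [sub_zero] at this
      exact this.trans_lt hk
    exact eq_of_hasDerivAt_uIcc hg (fun r hr => hY m r (hsub m hm r hr))
      (fun r hr => hY n r (hsub n hn r hr)) (by rw [hY0, hY0])
  -- The `n`-th solution lives on the open interval of radius `n + 1`, so index `⌈|h|⌉₊` is valid on
  -- a whole neighbourhood of `h`.
  refine ⟨fun h => Y ⌈|h|⌉₊ h, by simp [hY0], fun h => ?_⟩
  have hlt : ∀ r : ℝ, |r| < (⌈|r|⌉₊ : ℝ) + 1 := fun r => (Nat.le_ceil _).trans_lt (by linarith)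
  have heq : (fun h => Y ⌈|h|⌉₊ h) =ᶠ[𝓝 h] Y ⌈|h|⌉₊ := by
    filter_upwards [continuous_abs.continuousAt.eventually (gt_mem_nhds (hlt h))] with r hr
    exact hagree _ _ r (hlt r) hr
  exact (hY _ h (abs_lt.1 (hlt h))).congr_of_eventuallyEq heq

/-! ### Truncation of the drift -/

/-- The nearest point of `[-R, R]`. -/
def clampReal (R x : ℝ) : ℝ := max (-R) (min R x)

theorem lipschitzWith_clampReal (R : ℝ) : LipschitzWith 1 (clampReal R) :=
  (LipschitzWith.id.const_min R).const_max (-R)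

theorem clampReal_mem {R : ℝ} (hR : 0 ≤ R) (x : ℝ) : clampReal R x ∈ Icc (-R) R :=
  ⟨le_max_left _ _, max_le (by linarith) (min_le_left _ _)⟩

theorem clampReal_of_abs_le {R x : ℝ} (h : |x| ≤ R) : clampReal R x = x := by
  rw [abs_le] at h
  rw [clampReal, min_eq_right h.2, max_eq_right h.1]

/-- The drift `f` composed with the projection onto the square `[-R, R]²`. -/
def truncField (f : ℝ → ℝ → ℝ) (R t x : ℝ) : ℝ := f (clampReal R t) (clampReal R x)

theorem truncField_of_abs_le (f : ℝ → ℝ → ℝ) {R t x : ℝ} (ht : |t| ≤ R) (hx : |x| ≤ R) :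
    truncField f R t x = f t x := by
  rw [truncField, clampReal_of_abs_le ht, clampReal_of_abs_le hx]

/-- A `C¹` function is Lipschitz on a compact convex square, and clamping is 1-Lipschitz. The
dependence on time is included because continuity in `τ` needs it. -/
theorem exists_lipschitzWith_truncField {f : ℝ → ℝ → ℝ}
    (hf : ContDiff ℝ 1 (fun p : ℝ × ℝ => f p.1 p.2)) {R : ℝ} (hR : 0 ≤ R) :
    ∃ K : NNReal, ∀ t₁ t₂ x₁ x₂ : ℝ,
      |truncField f R t₁ x₁ - truncField f R t₂ x₂| ≤ K * (|t₁ - t₂| + |x₁ - x₂|) := by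
  obtain ⟨K, hK⟩ := (hf.contDiffOn (s := Icc (-R) R ×ˢ Icc (-R) R)).exists_lipschitzOnWith
    one_ne_zero ((convex_Icc _ _).prod (convex_Icc _ _)) (isCompact_Icc.prod isCompact_Icc)
  refine ⟨K, fun t₁ t₂ x₁ x₂ => ?_⟩
  have h := hK.dist_le_mul (clampReal R t₁, clampReal R x₁)
    ⟨clampReal_mem hR _, clampReal_mem hR _⟩ (clampReal R t₂, clampReal R x₂)
    ⟨clampReal_mem hR _, clampReal_mem hR _⟩
  have h1 := (lipschitzWith_clampReal R).dist_le_mul t₁ t₂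
  have h2 := (lipschitzWith_clampReal R).dist_le_mul x₁ x₂
  simp only [Prod.dist_eq, Real.dist_eq, NNReal.coe_one, one_mul] at h h1 h2
  refine h.trans (mul_le_mul_of_nonneg_left (max_le ?_ ?_) K.2)
  · linarith [abs_nonneg (x₁ - x₂)]
  · linarith [abs_nonneg (t₁ - t₂)]

theorem exists_abs_truncField_le {f : ℝ → ℝ → ℝ}
    (hf : Continuous (fun p : ℝ × ℝ => f p.1 p.2)) {R : ℝ} (hR : 0 ≤ R) :
    ∃ M : ℝ, ∀ t x, |truncField f R t x| ≤ M := by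
  obtain ⟨M, hM⟩ := (isCompact_Icc.prod isCompact_Icc : IsCompact (Icc (-R) R ×ˢ Icc (-R) R))
    |>.exists_bound_of_continuousOn hf.continuousOn
  exact ⟨M, fun t x => hM (_, _) ⟨clampReal_mem hR t, clampReal_mem hR x⟩⟩

instance : BorelSpace WienerSpace := ⟨rfl⟩

theorem continuous_wienerSpace_apply : Continuous fun p : WienerSpace × ℝ => p.1.1 p.2 :=
  (continuous_subtype_val.comp continuous_fst).eval continuous_snd

theorem exists_truncPath {f : ℝ → ℝ → ℝ} (hf : ContDiff ℝ 1 (fun p : ℝ × ℝ => f p.1 p.2))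
    (σ : ℝ) (R : ℕ) (τ : ℝ) (ω : WienerSpace) (x : ℝ) :
    ∃ y : ℝ → ℝ, y 0 = x ∧
      ∀ h, HasDerivAt y (truncField f R (τ + h) (y h + σ * ω.1 h)) h := by
  obtain ⟨K, hK⟩ := exists_lipschitzWith_truncField hf (Nat.cast_nonneg R)
  obtain ⟨M, hM⟩ := exists_abs_truncField_le hf.continuous (Nat.cast_nonneg R)
  refine exists_forall_hasDerivAt_of_lipschitz_bounded
    (g := fun h y => truncField f R (τ + h) (y + σ * ω.1 h)) (K := K) (fun h => ?_) (fun y => ?_)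
    (fun h y => hM _ _) x
  · refine LipschitzWith.of_dist_le_mul fun y₁ y₂ => ?_
    simpa [Real.dist_eq] using hK (τ + h) (τ + h) (y₁ + σ * ω.1 h) (y₂ + σ * ω.1 h)
  · have hc := (lipschitzWith_clampReal (R : ℝ)).continuous
    exact hf.continuous.comp
      ((hc.comp (by fun_prop)).prodMk (hc.comp (by fun_prop : Continuous fun h => y + σ * ω.1 h)))

/-- The solution `y` of `y' = f_R(τ + h, y + σ ω(h))`, `y(0) = x`, for the truncated drift `f_R`.
The pathwise solution for the drift `f_R` is `y + σ ω`. -/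
noncomputable def truncPath {f : ℝ → ℝ → ℝ} (hf : ContDiff ℝ 1 (fun p : ℝ × ℝ => f p.1 p.2))
    (σ : ℝ) (R : ℕ) (τ : ℝ) (ω : WienerSpace) (x : ℝ) : ℝ → ℝ :=
  (exists_truncPath hf σ R τ ω x).choose

/-! ### The truncated equation: uniqueness and joint continuity -/

section TruncPath

variable {f : ℝ → ℝ → ℝ} (hf : ContDiff ℝ 1 (fun p : ℝ × ℝ => f p.1 p.2)) (σ : ℝ)

theorem truncPath_zero (R : ℕ) (τ : ℝ) (ω : WienerSpace) (x : ℝ) :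
    truncPath hf σ R τ ω x 0 = x :=
  (exists_truncPath hf σ R τ ω x).choose_spec.1

theorem hasDerivAt_truncPath (R : ℕ) (τ : ℝ) (ω : WienerSpace) (x h : ℝ) :
    HasDerivAt (truncPath hf σ R τ ω x)
      (truncField f R (τ + h) (truncPath hf σ R τ ω x h + σ * ω.1 h)) h :=
  (exists_truncPath hf σ R τ ω x).choose_spec.2 h

theorem continuous_truncPath_apply (R : ℕ) (τ : ℝ) (ω : WienerSpace) (x : ℝ) :
    Continuous (truncPath hf σ R τ ω x) :=
  continuous_iff_continuousAt.2 fun h => (hasDerivAt_truncPath hf σ R τ ω x h).continuousAt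

/-- Uniqueness for the truncated equation. -/
theorem eq_truncPath {R : ℕ} {τ : ℝ} {ω : WienerSpace} {x t : ℝ} {y : ℝ → ℝ} (hy0 : y 0 = x)
    (hy : ∀ h ∈ uIcc 0 t, HasDerivAt y (truncField f R (τ + h) (y h + σ * ω.1 h)) h) :
    y t = truncPath hf σ R τ ω x t := by
  obtain ⟨K, hK⟩ := exists_lipschitzWith_truncField hf (Nat.cast_nonneg R)
  refine eq_of_hasDerivAt_uIcc (g := fun h y => truncField f R (τ + h) (y + σ * ω.1 h)) (K := K)
    (fun h => LipschitzWith.of_dist_le_mul fun y₁ y₂ => ?_) hy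
    (fun h _ => hasDerivAt_truncPath hf σ R τ ω x h) (by rw [hy0, truncPath_zero])
  simpa [Real.dist_eq] using hK (τ + h) (τ + h) (y₁ + σ * ω.1 h) (y₂ + σ * ω.1 h)

theorem continuous_truncPath (R : ℕ) :
    Continuous fun p : ℝ × ℝ × WienerSpace × ℝ => truncPath hf σ R p.2.1 p.2.2.1 p.2.2.2 p.1 := by
  obtain ⟨K, hK⟩ := exists_lipschitzWith_truncField hf (Nat.cast_nonneg R)
  rw [continuous_iff_continuousAt]
  rintro ⟨t₀, τ₀, ω₀, x₀⟩
  have hK1 : (0 : ℝ) < K + 1 := by positivity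
  set T : ℝ := |t₀| + 1 with hT
  -- the bound from Grönwall's inequality
  have hbound : ∀ η : ℝ, 0 < η → ∀ᶠ p : ℝ × ℝ × WienerSpace × ℝ in 𝓝 (t₀, τ₀, ω₀, x₀),
      |truncPath hf σ R p.2.1 p.2.2.1 p.2.2.2 p.1 - truncPath hf σ R τ₀ ω₀ x₀ p.1| ≤
        gronwallBound η (K + 1) ((K + 1) * (η + |σ| * η)) T := by
    intro η hη
    have hω : ∀ᶠ p : ℝ × ℝ × WienerSpace × ℝ in 𝓝 (t₀, τ₀, ω₀, x₀),
        ∀ h ∈ Icc (-T) T, |ω₀.1 h - p.2.2.1.1 h| < η := by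
      have hc : Continuous fun p : ℝ × ℝ × WienerSpace × ℝ => p.2.2.1.1 := by fun_prop
      exact Metric.tendstoUniformlyOn_iff.1
        (ContinuousMap.tendsto_iff_forall_isCompact_tendstoUniformlyOn.1
          (hc.tendsto (t₀, τ₀, ω₀, x₀)) (Icc (-T) T) isCompact_Icc) η hη
    have ht : ∀ᶠ p : ℝ × ℝ × WienerSpace × ℝ in 𝓝 (t₀, τ₀, ω₀, x₀), |p.1| < T :=
      (by fun_prop : Continuous fun p : ℝ × ℝ × WienerSpace × ℝ => |p.1|).continuousAt.eventually
        (gt_mem_nhds (by simp [hT]))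
    have hτ : ∀ᶠ p : ℝ × ℝ × WienerSpace × ℝ in 𝓝 (t₀, τ₀, ω₀, x₀), |τ₀ - p.2.1| < η :=
      (by fun_prop : Continuous fun p : ℝ × ℝ × WienerSpace × ℝ => |τ₀ - p.2.1|)
        |>.continuousAt.eventually (gt_mem_nhds (by simpa using hη))
    have hx : ∀ᶠ p : ℝ × ℝ × WienerSpace × ℝ in 𝓝 (t₀, τ₀, ω₀, x₀), |p.2.2.2 - x₀| < η :=
      (by fun_prop : Continuous fun p : ℝ × ℝ × WienerSpace × ℝ => |p.2.2.2 - x₀|)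
        |>.continuousAt.eventually (gt_mem_nhds (by simpa using hη))
    filter_upwards [hω, ht, hτ, hx] with p hω ht hτ hx
    have hmem : ∀ h ∈ uIcc 0 p.1, h ∈ Icc (-T) T := by
      intro h hh
      have := abs_sub_left_of_mem_uIcc hh
      simp only [sub_zero] at this
      exact abs_le.1 (this.trans ht.le)
    -- The reference solution is an approximate solution of the perturbed equation: its defect is
    -- controlled by the change of `τ` and the uniform change of the path on `[-T, T]`. The constant
    -- `K + 1` avoids the degenerate case `K = 0` of the Grönwall bound.
    refine (abs_sub_le_gronwallBound (K := K + 1) (δ := η) (ε := (K + 1) * (η + |σ| * η))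
      (g := fun h y => truncField f R (p.2.1 + h) (y + σ * p.2.2.1.1 h)) (fun h => ?_)
      (fun h _ => hasDerivAt_truncPath hf σ R p.2.1 p.2.2.1 p.2.2.2 h)
      (fun h _ => hasDerivAt_truncPath hf σ R τ₀ ω₀ x₀ h) (fun h hh => ?_) ?_).trans ?_
    · refine LipschitzWith.of_dist_le_mul fun y₁ y₂ => ?_
      have := hK (p.2.1 + h) (p.2.1 + h) (y₁ + σ * p.2.2.1.1 h) (y₂ + σ * p.2.2.1.1 h)
      simp only [sub_self, abs_zero, zero_add, add_sub_add_right_eq_sub] at this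
      simp only [Real.dist_eq, NNReal.coe_add, NNReal.coe_one]
      nlinarith [abs_nonneg (y₁ - y₂)]
    · refine (hK _ _ _ _).trans ?_
      rw [add_sub_add_right_eq_sub, add_sub_add_left_eq_sub, ← mul_sub, abs_mul]
      have h3 := (hω h (hmem h hh)).le
      have h4 : |σ| * |ω₀.1 h - p.2.2.1.1 h| ≤ |σ| * η := by gcongr
      have h5 : 0 ≤ |σ| * |ω₀.1 h - p.2.2.1.1 h| := by positivity
      exact mul_le_mul (by simp) (by linarith) (by positivity) hK1.le
    · rw [truncPath_zero, truncPath_zero]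
      exact hx.le
    · exact gronwallBound_mono hη.le (by positivity) (by positivity) ht.le
  have hlim : Tendsto (fun η : ℝ => gronwallBound η (K + 1) ((K + 1) * (η + |σ| * η)) T)
      (𝓝 0) (𝓝 0) := by
    simp only [gronwallBound_of_K_ne_0 hK1.ne']
    have : Continuous fun η : ℝ => η * Real.exp ((K + 1) * T) +
      (K + 1) * (η + |σ| * η) / (K + 1) * (Real.exp ((K + 1) * T) - 1) := by fun_prop
    simpa using this.tendsto 0
  rw [Metric.continuousAt_iff']
  intro ε hε
  obtain ⟨η, hη, hηε⟩ : ∃ η > 0, gronwallBound η (K + 1) ((K + 1) * (η + |σ| * η)) T < ε / 2 := by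
    obtain ⟨η, h1, h2⟩ := (((hlim.mono_left nhdsWithin_le_nhds).eventually
      (gt_mem_nhds (half_pos hε))).and (self_mem_nhdsWithin : Ioi (0 : ℝ) ∈ 𝓝[>] 0)).exists
    exact ⟨η, h2, h1⟩
  have hc : ∀ᶠ p : ℝ × ℝ × WienerSpace × ℝ in 𝓝 (t₀, τ₀, ω₀, x₀),
      dist (truncPath hf σ R τ₀ ω₀ x₀ p.1) (truncPath hf σ R τ₀ ω₀ x₀ t₀) < ε / 2 :=
    Metric.continuousAt_iff'.1 ((continuous_truncPath_apply hf σ R τ₀ ω₀ x₀).comp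
      continuous_fst).continuousAt _ (half_pos hε)
  filter_upwards [hbound η hη, hc] with p h1 h2
  refine (dist_triangle _ (truncPath hf σ R τ₀ ω₀ x₀ p.1) _).trans_lt ?_
  rw [Real.dist_eq] at h2 ⊢
  rw [Real.dist_eq]
  linarith

end TruncPath

/-! ### Truncated solutions inside the box -/

section TruncSolution

variable {f : ℝ → ℝ → ℝ} (hf : ContDiff ℝ 1 (fun p : ℝ × ℝ => f p.1 p.2)) (σ : ℝ)

/-- The pathwise solution for the truncated drift, as a function of the elapsed time. -/
noncomputable def truncSolution (R : ℕ) (τ : ℝ) (ω : WienerSpace) (x h : ℝ) : ℝ :=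
  truncPath hf σ R τ ω x h + σ * ω.1 h

/-- Up to the elapsed time `t`, the solution for the truncated drift does not leave the square
on which the truncated drift agrees with the original one. -/
def InBox (R : ℕ) (τ : ℝ) (ω : WienerSpace) (x t : ℝ) : Prop :=
  ∀ s ∈ uIcc 0 t, |τ + s| < R ∧ |truncSolution hf σ R τ ω x s| < R

theorem truncSolution_zero (R : ℕ) (τ : ℝ) (ω : WienerSpace) (x : ℝ) :
    truncSolution hf σ R τ ω x 0 = x := by
  rw [truncSolution, truncPath_zero, ω.2, mul_zero, add_zero]

theorem continuous_truncSolution (R : ℕ) :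
    Continuous fun p : ℝ × ℝ × WienerSpace × ℝ =>
      truncSolution hf σ R p.2.1 p.2.2.1 p.2.2.2 p.1 := by
  refine (continuous_truncPath hf σ R).add (continuous_const.mul ?_)
  exact continuous_wienerSpace_apply.comp (by fun_prop : Continuous
    fun p : ℝ × ℝ × WienerSpace × ℝ => (p.2.2.1, p.1))

theorem continuous_truncSolution_apply (R : ℕ) (τ : ℝ) (ω : WienerSpace) (x : ℝ) :
    Continuous (truncSolution hf σ R τ ω x) :=
  (continuous_truncSolution hf σ R).comp (by fun_prop : Continuous fun h : ℝ => (h, τ, ω, x))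

variable {hf σ}

theorem InBox.of_mem_uIcc {R : ℕ} {τ : ℝ} {ω : WienerSpace} {x s t : ℝ}
    (h : InBox hf σ R τ ω x t) (hs : s ∈ uIcc 0 t) : InBox hf σ R τ ω x s :=
  fun r hr => h r (uIcc_subset_uIcc left_mem_uIcc hs hr)

theorem InBox.truncSolution_eq {R R' : ℕ} {τ : ℝ} {ω : WienerSpace} {x t : ℝ}
    (h : InBox hf σ R τ ω x t) (hR : R ≤ R') :
    truncSolution hf σ R' τ ω x t = truncSolution hf σ R τ ω x t := by
  rw [truncSolution, truncSolution]
  congr 1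
  refine (eq_truncPath hf σ (truncPath_zero hf σ R τ ω x) fun s hs => ?_).symm
  have hd := hasDerivAt_truncPath hf σ R τ ω x s
  have hRR : (R : ℝ) ≤ R' := Nat.cast_le.2 hR
  obtain ⟨h1, h2⟩ := h s hs
  rw [truncSolution] at h2
  rwa [truncField_of_abs_le f h1.le h2.le,
    ← truncField_of_abs_le f (h1.le.trans hRR) (h2.le.trans hRR)] at hd

theorem InBox.mono {R R' : ℕ} {τ : ℝ} {ω : WienerSpace} {x t : ℝ}
    (h : InBox hf σ R τ ω x t) (hR : R ≤ R') : InBox hf σ R' τ ω x t := by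
  intro s hs
  rw [(h.of_mem_uIcc hs).truncSolution_eq hR]
  have hRR : (R : ℝ) ≤ R' := Nat.cast_le.2 hR
  exact ⟨(h s hs).1.trans_le hRR, (h s hs).2.trans_le hRR⟩

theorem truncSolution_eq_of_inBox {R R' : ℕ} {τ : ℝ} {ω : WienerSpace} {x t : ℝ}
    (h : InBox hf σ R τ ω x t) (h' : InBox hf σ R' τ ω x t) :
    truncSolution hf σ R τ ω x t = truncSolution hf σ R' τ ω x t := by
  rcases le_total R R' with hR | hR
  · exact (h.truncSolution_eq hR).symm
  · exact h'.truncSolution_eq hR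

variable (hf σ)

/-! ### The cocycle in terms of the truncated solutions -/

/-- A solution on a compact interval is bounded, so for large `R` it also solves the truncated
equation, where uniqueness applies. -/
theorem IsPathwiseSolution.exists_inBox {τ : ℝ} {ω : WienerSpace} {x t : ℝ} {u : ℝ → ℝ}
    (hu : IsPathwiseSolution f σ (wienerShift (-τ) ω) τ x (uIcc τ (t + τ)) u) :
    ∃ R : ℕ, InBox hf σ R τ ω x t ∧ truncSolution hf σ R τ ω x t = u (t + τ) := by
  obtain ⟨huc, hue⟩ := hu
  obtain ⟨B, hB⟩ := isCompact_uIcc.exists_bound_of_continuousOn huc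
  have hmem : ∀ h ∈ uIcc 0 t, τ + h ∈ uIcc τ (t + τ) := by
    intro h hh
    rw [mem_uIcc] at hh ⊢
    rcases hh with hh | hh
    · left; constructor <;> linarith
    · right; constructor <;> linarith
  have hproj : ∀ s, (projIcc (min 0 t) (max 0 t) min_le_max s : ℝ) ∈ uIcc 0 t :=
    fun s => (projIcc (min 0 t) (max 0 t) min_le_max s).2
  -- `u` is continuous only on the interval. Extending it by constants beyond the endpoints makes
  -- the integrand continuous on `ℝ`, so that `y` has two-sided derivatives at the endpoints too.
  set v : ℝ → ℝ := fun s => u (τ + projIcc (min 0 t) (max 0 t) min_le_max s) with hv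
  have hvc : Continuous v :=
    huc.comp_continuous (by fun_prop) fun s => hmem _ (hproj s)
  have hvu : ∀ s ∈ uIcc 0 t, v s = u (τ + s) := fun s hs => by
    simp only [hv]; rw [projIcc_of_mem _ hs]
  set y : ℝ → ℝ := fun h => x + ∫ r in (0 : ℝ)..h, f (τ + r) (v r) with hy
  have hfc : Continuous fun r => f (τ + r) (v r) :=
    hf.continuous.comp (by fun_prop : Continuous fun r => (τ + r, v r))
  have hyd : ∀ h, HasDerivAt y (f (τ + h) (v h)) h := fun h =>
    (hfc.integral_hasStrictDerivAt 0 h).hasDerivAt.const_add x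
  have hyv : ∀ s ∈ uIcc 0 t, y s + σ * ω.1 s = u (τ + s) := by
    intro s hs
    rw [hue _ (hmem s hs)]
    have h1 : ∫ r in (0 : ℝ)..s, f (τ + r) (v r) = ∫ r in τ..(τ + s), f r (u r) := by
      have h2 : ∫ r in (0 : ℝ)..s, f (τ + r) (v r) = ∫ r in (0 : ℝ)..s, f (τ + r) (u (τ + r)) :=
        intervalIntegral.integral_congr fun r hr => by
          simp only [hvu r (uIcc_subset_uIcc left_mem_uIcc hs hr)]
      rw [h2, intervalIntegral.integral_comp_add_left (fun r => f r (u r)), add_zero]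
    simp only [hy, h1, wienerShift, ContinuousMap.coe_mk, add_neg_cancel, ω.2]
    ring_nf
  obtain ⟨R, hR⟩ := exists_nat_gt (max B (|τ| + |t|))
  have hRτ : ∀ s ∈ uIcc 0 t, |τ + s| < R := by
    intro s hs
    have := abs_sub_left_of_mem_uIcc hs
    simp only [sub_zero] at this
    exact ((abs_add_le _ _).trans (by linarith)).trans_lt ((le_max_right _ _).trans_lt hR)
  have hRu : ∀ s ∈ uIcc 0 t, |u (τ + s)| < R := fun s hs =>
    (hB _ (hmem s hs)).trans_lt ((le_max_left _ _).trans_lt hR)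
  have hsol : ∀ s ∈ uIcc 0 t, truncSolution hf σ R τ ω x s = u (τ + s) := by
    intro s hs
    rw [truncSolution, ← eq_truncPath hf σ (y := y) (by simp [hy]) fun r hr => ?_]
    · exact hyv s hs
    · have hr' := uIcc_subset_uIcc left_mem_uIcc hs hr
      have := hyd r
      rwa [hvu r hr', ← truncField_of_abs_le f (hRτ r hr').le (hRu r hr').le, ← hyv r hr'] at this
  refine ⟨R, fun s hs => ⟨hRτ s hs, ?_⟩, ?_⟩
  · rw [hsol s hs]; exact hRu s hs
  · rw [hsol t right_mem_uIcc, add_comm]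

theorem InBox.isPathwiseSolution {R : ℕ} {τ : ℝ} {ω : WienerSpace} {x t : ℝ}
    (h : InBox hf σ R τ ω x t) :
    IsPathwiseSolution f σ (wienerShift (-τ) ω) τ x (uIcc τ (t + τ))
      (fun s => truncSolution hf σ R τ ω x (s - τ)) := by
  refine ⟨((continuous_truncSolution_apply hf σ R τ ω x).comp (by fun_prop)).continuousOn,
    fun s hs => ?_⟩
  have hs' : s - τ ∈ uIcc 0 t := by
    rw [mem_uIcc] at hs ⊢
    rcases hs with hs | hs
    · left; constructor <;> linarith
    · right; constructor <;> linarith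
  have h1 : ∫ r in τ..s, f r (truncSolution hf σ R τ ω x (r - τ)) =
      ∫ r in (0 : ℝ)..(s - τ), f (τ + r) (truncSolution hf σ R τ ω x r) := by
    have := intervalIntegral.integral_comp_add_left (a := 0) (b := s - τ)
      (fun r => f r (truncSolution hf σ R τ ω x (r - τ))) τ
    simp only [add_sub_cancel_left, add_zero, add_sub_cancel] at this
    exact this.symm
  have h2 : ∫ r in (0 : ℝ)..(s - τ), f (τ + r) (truncSolution hf σ R τ ω x r) =
      truncPath hf σ R τ ω x (s - τ) - truncPath hf σ R τ ω x 0 := by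
    refine intervalIntegral.integral_eq_sub_of_hasDerivAt (fun r hr => ?_)
      (Continuous.intervalIntegrable ?_ _ _)
    · obtain ⟨h3, h4⟩ := h r (uIcc_subset_uIcc left_mem_uIcc hs' hr)
      rw [← truncField_of_abs_le f h3.le h4.le]
      exact hasDerivAt_truncPath hf σ R τ ω x r
    · exact hf.continuous.comp ((continuous_const.add continuous_id).prodMk
        (continuous_truncSolution_apply hf σ R τ ω x))
  rw [h1, h2, truncPath_zero]
  simp only [truncSolution, wienerShift, ContinuousMap.coe_mk, add_neg_cancel, ω.2]
  ring_nf

/-- This removes the choice of a solution from the flow: by uniqueness every solution, the chosen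
one included, has the value of the truncated solutions. -/
theorem mem_sdeCocycle_iff {t τ : ℝ} {ω : WienerSpace} {x y : ℝ} :
    y ∈ sdeCocycle f σ t τ ω x ↔
      ∃ R : ℕ, InBox hf σ R τ ω x t ∧ truncSolution hf σ R τ ω x t = y := by
  constructor
  · rintro ⟨h, rfl⟩
    exact IsPathwiseSolution.exists_inBox hf σ h.choose_spec
  · rintro ⟨R, hR, rfl⟩
    have h : ∃ u, IsPathwiseSolution f σ (wienerShift (-τ) ω) τ x (uIcc τ (t + τ)) u :=
      ⟨_, hR.isPathwiseSolution⟩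
    obtain ⟨R', hR', he⟩ := IsPathwiseSolution.exists_inBox hf σ h.choose_spec
    exact ⟨h, he.symm.trans (truncSolution_eq_of_inBox hR' hR)⟩

include hf in
theorem mem_sdeCocycle_zero (τ : ℝ) (ω : WienerSpace) (x : ℝ) :
    x ∈ sdeCocycle f σ 0 τ ω x := by
  obtain ⟨R, hR⟩ := exists_nat_gt (max |τ| |x|)
  refine (mem_sdeCocycle_iff hf σ).2 ⟨R, fun s hs => ?_, truncSolution_zero hf σ R τ ω x⟩
  rw [uIcc_self, mem_singleton_iff] at hs
  rw [hs, truncSolution_zero, add_zero]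
  exact max_lt_iff.1 hR

include hf in
theorem exists_mem_sdeCocycle_of_mem_uIcc {s t τ : ℝ} {ω : WienerSpace} {x y : ℝ}
    (h : y ∈ sdeCocycle f σ t τ ω x) (hs : s ∈ uIcc 0 t) : ∃ z, z ∈ sdeCocycle f σ s τ ω x := by
  obtain ⟨R, hR, -⟩ := (mem_sdeCocycle_iff hf σ).1 h
  exact ⟨_, (mem_sdeCocycle_iff hf σ).2 ⟨R, hR.of_mem_uIcc hs, rfl⟩⟩

/-- The clamping acts on absolute time and on the state, neither of which changes under restarting;
hence the truncated flow is a cocycle with the same `R`. -/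
theorem truncSolution_shift (R : ℕ) (τ s : ℝ) (ω : WienerSpace) (x t : ℝ) :
    truncSolution hf σ R (τ + s) (wienerShift s ω) (truncSolution hf σ R τ ω x s) t =
      truncSolution hf σ R τ ω x (t + s) := by
  rw [truncSolution, ← eq_truncPath hf σ
    (y := fun h => truncPath hf σ R τ ω x (h + s) + σ * ω.1 s) (by simp [truncSolution])
    fun h _ => ?_]
  · simp only [wienerShift, ContinuousMap.coe_mk, truncSolution]
    ring
  · have := ((hasDerivAt_truncPath hf σ R τ ω x (h + s)).comp_add_const h s).add_const (σ * ω.1 s)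
    have h1 : τ + s + h = τ + (h + s) := by ring
    have h2 : truncPath hf σ R τ ω x (h + s) + σ * ω.1 s + σ * (wienerShift s ω).1 h =
        truncPath hf σ R τ ω x (h + s) + σ * ω.1 (h + s) := by
      simp only [wienerShift, ContinuousMap.coe_mk]
      ring
    rwa [h1, h2]

/-- The elapsed times visited directly and those visited via `s` differ only by times between `0`
and `s`, which the hypothesis covers for all signs of `s` and `t`. -/
theorem InBox.shift_iff {R : ℕ} {τ s : ℝ} {ω : WienerSpace} {x t : ℝ}
    (h : InBox hf σ R τ ω x s) :
    InBox hf σ R (τ + s) (wienerShift s ω) (truncSolution hf σ R τ ω x s) t ↔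
      InBox hf σ R τ ω x (t + s) := by
  constructor
  · intro h' r hr
    by_cases hrs : r ∈ uIcc 0 s
    · exact h r hrs
    · have := h' (r - s) (by
        rw [mem_uIcc] at hr hrs ⊢
        grind)
      rwa [truncSolution_shift, sub_add_cancel, add_assoc, add_sub_cancel] at this
  · intro h' r hr
    rw [truncSolution_shift, add_assoc, add_comm s r]
    by_cases hrs : r + s ∈ uIcc 0 s
    · exact h _ hrs
    · refine h' _ ?_
      rw [mem_uIcc] at hr hrs ⊢
      grind

include hf in
theorem sdeCocycle_add {t s τ : ℝ} {ω : WienerSpace} {x y : ℝ}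
    (hy : y ∈ sdeCocycle f σ s τ ω x) :
    sdeCocycle f σ (t + s) τ ω x = sdeCocycle f σ t (τ + s) (wienerShift s ω) y := by
  obtain ⟨R₀, hR₀, rfl⟩ := (mem_sdeCocycle_iff hf σ).1 hy
  ext z
  rw [mem_sdeCocycle_iff hf σ, mem_sdeCocycle_iff hf σ]
  constructor
  · rintro ⟨R, hR, rfl⟩
    have h0 := hR₀.mono (le_max_left R₀ R)
    refine ⟨max R₀ R, ?_, ?_⟩
    · rw [← hR₀.truncSolution_eq (le_max_left R₀ R), h0.shift_iff]
      exact hR.mono (le_max_right _ _)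
    · rw [← hR₀.truncSolution_eq (le_max_left R₀ R), truncSolution_shift,
        hR.truncSolution_eq (le_max_right _ _)]
  · rintro ⟨R, hR, rfl⟩
    have h0 := hR₀.mono (le_max_left R₀ R)
    have h1 := hR.mono (le_max_right R₀ R)
    rw [← hR.truncSolution_eq (le_max_right R₀ R)]
    rw [← hR₀.truncSolution_eq (le_max_left R₀ R)] at h1 ⊢
    exact ⟨max R₀ R, (h0.shift_iff).1 h1, (truncSolution_shift ..).symm⟩

/-- Rescaling replaces the interval that moves with `t` by the fixed compact `[0, 1]`, as the
openness of the box condition requires. -/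
theorem mem_uIcc_zero_iff {s t : ℝ} : s ∈ uIcc 0 t ↔ ∃ r ∈ Icc (0 : ℝ) 1, r * t = s := by
  rw [← segment_eq_uIcc, segment_eq_image]
  simp

theorem isOpen_setOf_inBox (R : ℕ) :
    IsOpen {p : ℝ × ℝ × WienerSpace × ℝ | InBox hf σ R p.2.1 p.2.2.1 p.2.2.2 p.1} := by
  rw [isOpen_iff_mem_nhds]
  intro p hp
  have : ∀ᶠ q : ℝ × ℝ × WienerSpace × ℝ in 𝓝 p, ∀ r ∈ Icc (0 : ℝ) 1,
      |q.2.1 + r * q.1| < R ∧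
        |truncSolution hf σ R q.2.1 q.2.2.1 q.2.2.2 (r * q.1)| < R := by
    refine isCompact_Icc.eventually_forall_of_forall_eventually fun r hr => ?_
    obtain ⟨h1, h2⟩ := hp _ (mem_uIcc_zero_iff.2 ⟨r, hr, rfl⟩)
    have c1 : Continuous fun z : (ℝ × ℝ × WienerSpace × ℝ) × ℝ => |z.1.2.1 + z.2 * z.1.1| := by
      fun_prop
    have c2 : Continuous fun z : (ℝ × ℝ × WienerSpace × ℝ) × ℝ =>
        |truncSolution hf σ R z.1.2.1 z.1.2.2.1 z.1.2.2.2 (z.2 * z.1.1)| :=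
      ((continuous_truncSolution hf σ R).comp (by fun_prop : Continuous
        fun z : (ℝ × ℝ × WienerSpace × ℝ) × ℝ =>
          (z.2 * z.1.1, z.1.2.1, z.1.2.2.1, z.1.2.2.2))).abs
    exact (c1.continuousAt.eventually (gt_mem_nhds h1)).and
      (c2.continuousAt.eventually (gt_mem_nhds h2))
  filter_upwards [this] with q hq s hs
  obtain ⟨r, hr, rfl⟩ := mem_uIcc_zero_iff.1 hs
  exact hq r hr

theorem setOf_mem_preimage_sdeCocycle (B : Set ℝ) :
    {p : ℝ × ℝ × WienerSpace × ℝ |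
        p.2.2.2 ∈ (sdeCocycle f σ p.1 p.2.1 p.2.2.1).preimage B} =
      ⋃ R : ℕ, {p | InBox hf σ R p.2.1 p.2.2.1 p.2.2.2 p.1} ∩
        (fun p => truncSolution hf σ R p.2.1 p.2.2.1 p.2.2.2 p.1) ⁻¹' B := by
  ext p
  simp only [PFun.mem_preimage, mem_sdeCocycle_iff hf σ, mem_ofPred_eq, mem_iUnion, mem_inter_iff,
    mem_preimage]
  constructor
  · rintro ⟨_, hy, R, hR, rfl⟩
    exact ⟨R, hR, hy⟩
  · rintro ⟨R, hR, hy⟩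
    exact ⟨_, hy, R, hR, rfl⟩

include hf in
theorem isOpen_setOf_mem_preimage_sdeCocycle {U : Set ℝ} (hU : IsOpen U) :
    IsOpen {p : ℝ × ℝ × WienerSpace × ℝ |
      p.2.2.2 ∈ (sdeCocycle f σ p.1 p.2.1 p.2.2.1).preimage U} := by
  rw [setOf_mem_preimage_sdeCocycle hf]
  exact isOpen_iUnion fun R =>
    (isOpen_setOf_inBox hf σ R).inter (hU.preimage (continuous_truncSolution hf σ R))

/-! ### The energy estimate and the existence of forward solutions -/

/-- The forcing term in the energy estimate for `x - σ ω`. -/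
noncomputable def energyForcing (f : ℝ → ℝ → ℝ) (σ L₁ L₂ τ : ℝ) (ω : WienerSpace) (r : ℝ) : ℝ :=
  2 * L₁ + |f (τ + r) (σ * ω.1 r)| ^ 2 / L₂

theorem energyForcing_nonneg {L₁ L₂ : ℝ} (hL₁ : 0 ≤ L₁) (hL₂ : 0 < L₂) (τ : ℝ) (ω : WienerSpace)
    (r : ℝ) : 0 ≤ energyForcing f σ L₁ L₂ τ ω r := by
  unfold energyForcing
  positivity

include hf in
theorem continuous_energyForcing (L₁ L₂ : ℝ) :
    Continuous fun p : (ℝ × WienerSpace) × ℝ => energyForcing f σ L₁ L₂ p.1.1 p.1.2 p.2 := by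
  have hω : Continuous fun p : (ℝ × WienerSpace) × ℝ => p.1.2.1 p.2 :=
    continuous_wienerSpace_apply.comp
      (by fun_prop : Continuous fun p : (ℝ × WienerSpace) × ℝ => (p.1.2, p.2))
  have h := hf.continuous.comp (by fun_prop : Continuous fun p : (ℝ × WienerSpace) × ℝ =>
    (p.1.1 + p.2, σ * p.1.2.1 p.2))
  exact continuous_const.add ((h.abs.pow 2).div_const _)

include hf in
theorem continuous_exp_mul_energyForcing (L₁ L₂ c τ : ℝ) (ω : WienerSpace) :
    Continuous fun r => Real.exp (c * r) * energyForcing f σ L₁ L₂ τ ω r :=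
  (by fun_prop : Continuous fun r => Real.exp (c * r)).mul
    ((continuous_energyForcing hf σ L₁ L₂).comp
      (by fun_prop : Continuous fun r : ℝ => ((τ, ω), r)))

/-- Dissipativity supplies `-2 L₂ y²`. Young's inequality for `2 y G` spends one half of it; the
other half absorbs `c y²`. -/
theorem energy_deriv_nonpos {L₁ L₂ c y F G : ℝ} (hL₂ : 0 < L₂) (hc : c ≤ L₂)
    (h : y * (F - G) ≤ L₁ - L₂ * |y| ^ 2) :
    c * y ^ 2 + 2 * y * F - (2 * L₁ + |G| ^ 2 / L₂) ≤ 0 := by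
  rw [sq_abs] at h ⊢
  have h1 : 2 * y * G ≤ L₂ * y ^ 2 + G ^ 2 / L₂ := by
    have : 0 ≤ (L₂ * y - G) ^ 2 / L₂ := by positivity
    have h2 : (L₂ * y - G) ^ 2 / L₂ = L₂ * y ^ 2 - 2 * y * G + G ^ 2 / L₂ := by
      field_simp
      ring
    linarith
  nlinarith [mul_le_mul_of_nonneg_right hc (sq_nonneg y)]

/-- The weighted energy minus the accumulated forcing is antitone. The box is required only on the
open interval and with weak inequalities, so that the estimate reaches a first exit time. -/
theorem truncPath_energy_le {L₁ L₂ c : ℝ} (hL₂ : 0 < L₂)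
    (hdiss : ∀ t x₁ x₂ : ℝ, (x₁ - x₂) * (f t x₁ - f t x₂) ≤ L₁ - L₂ * |x₁ - x₂| ^ 2)
    (hc : c ≤ L₂) {R : ℕ} {τ : ℝ} {ω : WienerSpace} {x a b : ℝ} (hab : a ≤ b)
    (hbox : ∀ r ∈ Ioo a b, |τ + r| ≤ R ∧ |truncSolution hf σ R τ ω x r| ≤ R) :
    Real.exp (c * b) * truncPath hf σ R τ ω x b ^ 2 ≤
      Real.exp (c * a) * truncPath hf σ R τ ω x a ^ 2 +
        ∫ r in a..b, Real.exp (c * r) * energyForcing f σ L₁ L₂ τ ω r := by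
  set y := truncPath hf σ R τ ω x with hy
  have hgc := continuous_exp_mul_energyForcing hf σ L₁ L₂ c τ ω
  have hd : ∀ h, HasDerivAt (fun h => Real.exp (c * h) * y h ^ 2 -
      ∫ r in a..h, Real.exp (c * r) * energyForcing f σ L₁ L₂ τ ω r)
      (Real.exp (c * h) * (c * y h ^ 2 + 2 * y h * truncField f R (τ + h) (y h + σ * ω.1 h) -
        energyForcing f σ L₁ L₂ τ ω h)) h := by
    intro h
    have h1 : HasDerivAt (fun h => Real.exp (c * h)) (Real.exp (c * h) * c) h := by
      simpa using ((hasDerivAt_id h).const_mul c).exp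
    have h2 := (hasDerivAt_truncPath hf σ R τ ω x h).pow 2
    refine ((h1.mul h2).sub (hgc.integral_hasStrictDerivAt a h).hasDerivAt).congr_deriv ?_
    simp only [Pi.pow_apply, ← hy]
    push_cast
    ring
  have hanti := antitoneOn_of_deriv_nonpos (convex_Icc a b)
    (fun h _ => (hd h).continuousAt.continuousWithinAt)
    (fun h _ => (hd h).differentiableAt.differentiableWithinAt) (fun h hh => by
      rw [interior_Icc] at hh
      have hb := hbox h hh
      rw [truncSolution] at hb
      rw [(hd h).deriv, truncField_of_abs_le f hb.1 hb.2]
      refine mul_nonpos_of_nonneg_of_nonpos (Real.exp_pos _).le (energy_deriv_nonpos hL₂ hc ?_)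
      have := hdiss (τ + h) (y h + σ * ω.1 h) (σ * ω.1 h)
      rwa [add_sub_cancel_right] at this)
  have := hanti (left_mem_Icc.2 hab) (right_mem_Icc.2 hab) hab
  simp only [intervalIntegral.integral_same] at this
  linarith

include hf in
/-- Two values of the same trajectory satisfy the energy estimate. -/
theorem sdeCocycle_energy_le {L₁ L₂ c : ℝ} (hL₂ : 0 < L₂)
    (hdiss : ∀ t x₁ x₂ : ℝ, (x₁ - x₂) * (f t x₁ - f t x₂) ≤ L₁ - L₂ * |x₁ - x₂| ^ 2)
    (hc : c ≤ L₂) {τ : ℝ} {ω : WienerSpace} {x a b u v : ℝ} (hab : a ≤ b)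
    (hu : u ∈ sdeCocycle f σ a τ ω x) (hv : v ∈ sdeCocycle f σ b τ ω x) :
    Real.exp (c * b) * (v - σ * ω.1 b) ^ 2 ≤
      Real.exp (c * a) * (u - σ * ω.1 a) ^ 2 +
        ∫ r in a..b, Real.exp (c * r) * energyForcing f σ L₁ L₂ τ ω r := by
  obtain ⟨R₁, hR₁, rfl⟩ := (mem_sdeCocycle_iff hf σ).1 hu
  obtain ⟨R₂, hR₂, rfl⟩ := (mem_sdeCocycle_iff hf σ).1 hv
  rw [← hR₁.truncSolution_eq (le_max_left R₁ R₂), ← hR₂.truncSolution_eq (le_max_right R₁ R₂),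
    truncSolution, truncSolution, add_sub_cancel_right, add_sub_cancel_right]
  refine truncPath_energy_le hf σ hL₂ hdiss hc hab fun r hr => ?_
  -- Whatever the signs of `a` and `b`, one of the two trajectory pieces starting at `0` passes
  -- through `r`.
  have : r ∈ uIcc 0 a ∨ r ∈ uIcc 0 b := by
    rw [mem_uIcc, mem_uIcc]
    have := hr.1
    have := hr.2
    grind
  rcases this with h | h
  · exact ((hR₁.mono (le_max_left R₁ R₂)) r h).imp le_of_lt le_of_lt
  · exact ((hR₂.mono (le_max_right R₁ R₂)) r h).imp le_of_lt le_of_lt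

include hf in
theorem exists_mem_sdeCocycle_of_nonneg (hdiss : IsDissipative f) {t : ℝ} (ht : 0 ≤ t) (τ : ℝ)
    (ω : WienerSpace) (x : ℝ) : ∃ y, y ∈ sdeCocycle f σ t τ ω x := by
  obtain ⟨L₁, L₂, hL₁, hL₂, hdiss⟩ := hdiss
  have hgc := continuous_exp_mul_energyForcing hf σ L₁ L₂ L₂ τ ω
  set E : ℝ := x ^ 2 + ∫ r in (0 : ℝ)..t, Real.exp (L₂ * r) * energyForcing f σ L₁ L₂ τ ω r
    with hE
  obtain ⟨B, hB⟩ := (isCompact_Icc (a := (0 : ℝ)) (b := t)).exists_bound_of_continuousOn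
    (f := fun s => σ * ω.1 s) (by fun_prop)
  -- `√E + B` is the a priori bound on `[0, t]`. At the first time the solution reached the level
  -- `R`, the energy estimate would still hold and contradict this choice.
  obtain ⟨R, hR⟩ := exists_nat_gt (max (√E + B) (|τ| + t))
  suffices h : ∀ s ∈ Icc 0 t, |truncSolution hf σ R τ ω x s| < R by
    refine ⟨_, (mem_sdeCocycle_iff hf σ).2 ⟨R, fun s hs => ?_, rfl⟩⟩
    rw [uIcc_of_le ht] at hs
    refine ⟨((abs_add_le _ _).trans ?_).trans_lt ((le_max_right _ _).trans_lt hR), h s hs⟩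
    rw [abs_of_nonneg hs.1]
    linarith [hs.2]
  by_contra! hcon
  obtain ⟨s₁, hs₁, hs₁R⟩ := hcon
  have hcpt : IsCompact (Icc 0 t ∩ {s | (R : ℝ) ≤ |truncSolution hf σ R τ ω x s|}) :=
    isCompact_Icc.inter_right (isClosed_le continuous_const
      (continuous_truncSolution_apply hf σ R τ ω x).abs)
  obtain ⟨s, ⟨hs, hsR⟩, hmin⟩ := hcpt.exists_isLeast ⟨s₁, hs₁, hs₁R⟩
  have hen := truncPath_energy_le hf σ hL₂ hdiss le_rfl (R := R) (τ := τ) (ω := ω) (x := x) hs.1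
    (fun r hr => by
      constructor
      · refine ((abs_add_le _ _).trans ?_).trans ((le_max_right _ _).trans hR.le)
        rw [abs_of_pos hr.1]
        linarith [hr.2, hs.2]
      · by_contra! hr'
        exact absurd (hmin ⟨⟨hr.1.le, hr.2.le.trans hs.2⟩, hr'.le⟩) (not_le.2 hr.2))
  rw [mul_zero, Real.exp_zero, one_mul, truncPath_zero] at hen
  have hint : ∫ r in (0 : ℝ)..s, Real.exp (L₂ * r) * energyForcing f σ L₁ L₂ τ ω r ≤
      ∫ r in (0 : ℝ)..t, Real.exp (L₂ * r) * energyForcing f σ L₁ L₂ τ ω r :=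
    intervalIntegral.integral_mono_interval le_rfl hs.1 hs.2
      (Eventually.of_forall fun r => mul_nonneg (Real.exp_pos _).le
        (energyForcing_nonneg σ hL₁ hL₂ τ ω r)) (hgc.intervalIntegrable _ _)
  have hexp : 1 ≤ Real.exp (L₂ * s) := Real.one_le_exp (mul_nonneg hL₂.le hs.1)
  have hsq : truncPath hf σ R τ ω x s ^ 2 ≤ E := by
    nlinarith [sq_nonneg (truncPath hf σ R τ ω x s)]
  have habs : |truncPath hf σ R τ ω x s| ≤ √E := Real.abs_le_sqrt hsq
  have h1 : |truncSolution hf σ R τ ω x s| ≤ √E + B :=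
    (abs_add_le _ _).trans (add_le_add habs (hB s hs))
  exact absurd (hsR.trans h1) (not_le.2 ((le_max_left _ _).trans_lt hR))

end TruncSolution

/-! ### The Wiener space as a measurable space -/

instance : SecondCountableTopology WienerSpace :=
  Topology.IsEmbedding.subtypeVal.secondCountableTopology

theorem measurable_wienerSpace_apply (t : ℝ) : Measurable fun ω : WienerSpace => ω.1 t :=
  (continuous_wienerSpace_apply.comp
    (by fun_prop : Continuous fun ω : WienerSpace => (ω, t))).measurable

theorem measurable_wienerSpace_sub (s t : ℝ) :
    Measurable fun ω : WienerSpace => ω.1 t - ω.1 s :=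
  (measurable_wienerSpace_apply t).sub (measurable_wienerSpace_apply s)

theorem measurable_increments {n : ℕ} (t : Fin (n + 1) → ℝ) :
    Measurable fun (ω : WienerSpace) (i : Fin n) => ω.1 (t i.succ) - ω.1 (t i.castSucc) :=
  measurable_pi_lambda _ fun _ => measurable_wienerSpace_sub _ _

/-- By compactness the image of `K` keeps a positive distance from the complement of `U`, and a
closed distance condition can be tested on a dense subset. A subbasic open set thereby becomes a
countable combination of coordinate conditions. -/
theorem ContinuousMap.mapsTo_iff_exists_le_infDist {K D U : Set ℝ} (hK : IsCompact K)
    (hDK : D ⊆ K) (hKD : K ⊆ closure D) (hU : IsOpen U) (hU' : Uᶜ.Nonempty) (g : C(ℝ, ℝ)) :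
    MapsTo g K U ↔ ∃ n : ℕ, ∀ d ∈ D, 1 / ((n : ℝ) + 1) ≤ Metric.infDist (g d) Uᶜ := by
  have hc : Continuous fun r => Metric.infDist (g r) Uᶜ :=
    (Metric.continuous_infDist_pt _).comp g.continuous
  constructor
  · intro h
    rcases K.eq_empty_or_nonempty with rfl | hne
    · exact ⟨0, fun d hd => absurd (hDK hd) (notMem_empty d)⟩
    obtain ⟨r, hr, hmin⟩ := hK.exists_isMinOn hne hc.continuousOn
    have hpos : 0 < Metric.infDist (g r) Uᶜ :=
      (hU.isClosed_compl.notMem_iff_infDist_pos hU').1 (not_not.2 (h hr))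
    obtain ⟨n, hn⟩ := exists_nat_one_div_lt hpos
    exact ⟨n, fun d hd => hn.le.trans (hmin (hDK hd))⟩
  · rintro ⟨n, hn⟩ r hr
    have hcl : IsClosed {r | 1 / ((n : ℝ) + 1) ≤ Metric.infDist (g r) Uᶜ} :=
      isClosed_le continuous_const hc
    have h1 : 1 / ((n : ℝ) + 1) ≤ Metric.infDist (g r) Uᶜ :=
      closure_minimal (fun d hd => hn d hd) hcl (hKD hr)
    by_contra hgr
    have h2 := (hU.isClosed_compl.notMem_iff_infDist_pos hU').2
      (lt_of_lt_of_le (by positivity) h1)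
    exact h2 hgr

/-- The Borel σ-algebra of the Wiener space is generated by the coordinates. -/
theorem borel_wienerSpace_le :
    borel WienerSpace ≤ MeasurableSpace.comap (fun (ω : WienerSpace) (t : ℝ) => ω.1 t)
      MeasurableSpace.pi := by
  rw [borel_comap (f := (Subtype.val : WienerSpace → C(ℝ, ℝ))),
    borel_eq_generateFrom_of_subbasis ContinuousMap.compactOpen_eq,
    MeasurableSpace.comap_generateFrom]
  refine MeasurableSpace.generateFrom_le ?_
  rintro _ ⟨_, ⟨K, hK, U, hU, rfl⟩, rfl⟩
  rcases (Uᶜ).eq_empty_or_nonempty with hU' | hU'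
  · rw [compl_empty_iff] at hU'
    simp [hU', MapsTo]
  obtain ⟨D, hDK, hDc, hKD⟩ :=
    (TopologicalSpace.IsSeparable.of_separableSpace K).exists_countable_dense_subset
  have heq : Subtype.val ⁻¹' {g : C(ℝ, ℝ) | MapsTo g K U} =
      (fun (ω : WienerSpace) (t : ℝ) => ω.1 t) ⁻¹'
        ⋃ n : ℕ, ⋂ d ∈ D, {w | 1 / ((n : ℝ) + 1) ≤ Metric.infDist (w d) Uᶜ} := by
    ext ω
    simp only [mem_preimage, mem_ofPred_eq, mem_iUnion, mem_iInter]
    exact ContinuousMap.mapsTo_iff_exists_le_infDist hK hDK hKD hU hU' ω.1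
  change MeasurableSet[MeasurableSpace.comap _ _]
    (Subtype.val ⁻¹' {g : C(ℝ, ℝ) | MapsTo g K U})
  rw [heq]
  refine ⟨_, MeasurableSet.iUnion fun n => MeasurableSet.biInter hDc fun d _ => ?_, rfl⟩
  exact measurableSet_le measurable_const
    ((Metric.continuous_infDist_pt Uᶜ).measurable.comp (measurable_pi_apply d))

/-- Partial sums of the increments along an ordered finite family of times. -/
theorem sum_increments_eq {n : ℕ} (w : Fin (n + 1) → ℝ) (k : Fin (n + 1)) :
    ∑ j : Fin n with j.castSucc < k, (w j.succ - w j.castSucc) = w k - w 0 := by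
  rcases Fin.eq_zero_or_eq_succ k with rfl | ⟨a, rfl⟩
  · simp
  · rw [← Fin.sum_Iic_sub a w]
    refine Finset.sum_congr (Finset.ext fun j => ?_) fun _ _ => rfl
    rw [Finset.mem_filter_univ, Finset.mem_Iic, Fin.castSucc_lt_succ_iff]

/-- Paths vanish at `0`, so ordered increments determine the finite-dimensional laws; these
determine the law on `ℝ → ℝ`, and the coordinates generate the Borel σ-algebra. -/
theorem wienerSpace_measure_ext {P Q : Measure WienerSpace} [IsProbabilityMeasure P]
    [IsProbabilityMeasure Q]
    (h : ∀ (n : ℕ) (t : Fin (n + 1) → ℝ), Monotone t →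
      P.map (fun ω (i : Fin n) => ω.1 (t i.succ) - ω.1 (t i.castSucc)) =
        Q.map (fun ω (i : Fin n) => ω.1 (t i.succ) - ω.1 (t i.castSucc))) : P = Q := by
  set e : WienerSpace → ℝ → ℝ := fun ω t => ω.1 t with he
  have hem : Measurable e := measurable_pi_lambda _ measurable_wienerSpace_apply
  have hfin : ∀ I : Finset ℝ, (P.map e).map I.restrict = (Q.map e).map I.restrict := by
    intro I
    rw [Measure.map_map (Finset.measurable_restrict I) hem,
      Measure.map_map (Finset.measurable_restrict I) hem]
    -- With `0` among the times, each coordinate is a difference of two partial sums of increments,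
    -- one ending at its time and one at `0`.
    obtain ⟨n, hn⟩ : ∃ n, (insert 0 I).card = n + 1 :=
      Nat.exists_eq_succ_of_ne_zero (Finset.card_ne_zero.2 ⟨0, Finset.mem_insert_self _ _⟩)
    set t := (insert 0 I).orderEmbOfFin hn
    have hrange : ∀ a ∈ insert 0 I, ∃ k, t k = a := fun a ha => by
      have : a ∈ range t := by rw [Finset.range_orderEmbOfFin]; exact ha
      exact this
    obtain ⟨k₀, hk₀⟩ := hrange 0 (Finset.mem_insert_self _ _)
    have hI : ∀ i : I, ∃ k, t k = i := fun i => hrange i (Finset.mem_insert_of_mem i.2)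
    choose k hk using hI
    set S : (Fin n → ℝ) → (I → ℝ) := fun d i =>
      ∑ j : Fin n with j.castSucc < k i, d j - ∑ j : Fin n with j.castSucc < k₀, d j with hS
    have hSm : Measurable S := by fun_prop
    have hfact : (I.restrict ∘ e) = S ∘ fun (ω : WienerSpace) (i : Fin n) =>
        ω.1 (t i.succ) - ω.1 (t i.castSucc) := by
      ext ω i
      simp only [Function.comp_apply, hS, Finset.restrict, he]
      rw [sum_increments_eq (fun j => ω.1 (t j)), sum_increments_eq (fun j => ω.1 (t j)),
        hk, hk₀, ω.2]
      ring
    have hm := measurable_increments t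
    rw [hfact, ← Measure.map_map hSm hm, ← Measure.map_map hSm hm, h n t t.monotone]
  have := Measure.isProbabilityMeasure_map (μ := P) hem.aemeasurable
  have := Measure.isProbabilityMeasure_map (μ := Q) hem.aemeasurable
  have hmap : P.map e = Q.map e := by
    have hJ : ∀ J : Finset ℝ, IsFiniteMeasure ((Q.map e).map J.restrict) := fun J => inferInstance
    exact IsProjectiveLimit.unique (P := fun J : Finset ℝ => (Q.map e).map J.restrict)
      hfin fun J => rfl
  ext s hs
  obtain ⟨B, hB, rfl⟩ := borel_wienerSpace_le s hs
  rw [← Measure.map_apply hem hB, ← Measure.map_apply hem hB, hmap]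

/-! ### The Wiener shift -/

theorem wienerShift_apply (t : ℝ) (ω : WienerSpace) (s : ℝ) :
    (wienerShift t ω).1 s = ω.1 (s + t) - ω.1 t := rfl

theorem continuous_wienerShift : Continuous fun p : ℝ × WienerSpace => wienerShift p.1 p.2 := by
  refine Continuous.subtype_mk (ContinuousMap.continuous_of_continuous_uncurry _ ?_) _
  have h1 : Continuous fun p : (ℝ × WienerSpace) × ℝ => p.1.2.1 (p.2 + p.1.1) :=
    continuous_wienerSpace_apply.comp (by fun_prop : Continuous
      fun p : (ℝ × WienerSpace) × ℝ => (p.1.2, p.2 + p.1.1))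
  have h2 : Continuous fun p : (ℝ × WienerSpace) × ℝ => p.1.2.1 p.1.1 :=
    continuous_wienerSpace_apply.comp (by fun_prop : Continuous
      fun p : (ℝ × WienerSpace) × ℝ => (p.1.2, p.1.1))
  exact h1.sub h2

theorem wienerShift_zero (ω : WienerSpace) : wienerShift 0 ω = ω := by
  apply Subtype.ext
  ext s
  simp [wienerShift_apply, ω.2]

theorem wienerShift_add (t s : ℝ) (ω : WienerSpace) :
    wienerShift (t + s) ω = wienerShift t (wienerShift s ω) := by
  apply Subtype.ext
  ext r
  simp only [wienerShift_apply]
  rw [sub_sub_sub_cancel_right, add_assoc]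

theorem IsWienerMeasure.map_increments {P : Measure WienerSpace} (hP : IsWienerMeasure P)
    {n : ℕ} {t : Fin (n + 1) → ℝ} (ht : Monotone t) :
    P.map (fun ω (i : Fin n) => ω.1 (t i.succ) - ω.1 (t i.castSucc)) =
      Measure.pi fun i : Fin n => gaussianReal 0 (Real.toNNReal (t i.succ - t i.castSucc)) := by
  have := hP.isProbabilityMeasure
  rw [(iIndepFun_iff_map_fun_eq_pi_map fun i =>
    (measurable_wienerSpace_sub _ _).aemeasurable).1 (hP.indep n t ht)]
  congr 1
  ext1 i
  exact hP.gaussian _ _ (ht (Fin.castSucc_le_succ i))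

theorem IsWienerMeasure.measurePreserving_wienerShift {P : Measure WienerSpace}
    (hP : IsWienerMeasure P) (s : ℝ) : MeasurePreserving (wienerShift s) P P := by
  have := hP.isProbabilityMeasure
  have hm : Measurable (wienerShift s) :=
    (continuous_wienerShift.comp (by fun_prop : Continuous fun ω : WienerSpace => (s, ω))).measurable
  have := Measure.isProbabilityMeasure_map (μ := P) hm.aemeasurable
  refine ⟨hm, wienerSpace_measure_ext fun n t ht => ?_⟩
  rw [Measure.map_map (measurable_increments t) hm, hP.map_increments ht]
  have hts : Monotone fun i => t i + s := fun i j hij => by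
    have := ht hij
    simpa using this
  have h := hP.map_increments hts
  simp only [add_sub_add_right_eq_sub] at h
  rw [← h]
  congr 1
  ext ω i
  simp only [Function.comp_apply, wienerShift_apply, sub_sub_sub_cancel_right]

theorem IsWienerMeasure.isMetricDS {P : Measure WienerSpace} (hP : IsWienerMeasure P) :
    IsMetricDS P wienerShift where
  measurable := continuous_wienerShift.measurable
  zero := wienerShift_zero
  add := wienerShift_add
  measurePreserving := hP.measurePreserving_wienerShift

/-! ### Growth of the Wiener paths -/

/-- At most cubic growth of a path. -/
def HasCubicGrowth (u : ℝ → ℝ) : Prop := ∃ C : ℝ, ∀ t, |u t| ≤ C * (1 + |t|) ^ 3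

theorem HasCubicGrowth.hasSubexponentialGrowth {u : ℝ → ℝ} (hu : HasCubicGrowth u) :
    HasSubexponentialGrowth u := by
  obtain ⟨C, hC⟩ := hu
  intro ε hε
  have h1 : Tendsto (fun x : ℝ => x ^ 3 / Real.exp (ε * x)) atTop (𝓝 0) :=
    (isLittleO_pow_exp_pos_mul_atTop 3 hε).tendsto_div_nhds_zero
  have habs : Tendsto (fun t : ℝ => 1 + |t|) (atBot ⊔ atTop) atTop :=
    tendsto_atTop_add_const_left _ _
      (tendsto_sup.2 ⟨tendsto_abs_atBot_atTop, tendsto_abs_atTop_atTop⟩)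
  have h2 := (h1.comp habs).const_mul (C * Real.exp ε)
  rw [mul_zero] at h2
  refine squeeze_zero_norm (fun t => ?_) h2
  rw [Real.norm_eq_abs, abs_mul, abs_of_pos (Real.exp_pos _)]
  refine (mul_le_mul_of_nonneg_right (hC t) (Real.exp_pos _).le).trans_eq ?_
  simp only [Function.comp_apply]
  rw [div_eq_mul_inv, ← Real.exp_neg,
    show -(ε * (1 + |t|)) = -ε + -ε * |t| by ring, Real.exp_add, Real.exp_neg]
  field_simp

theorem HasCubicGrowth.comp_add {u : ℝ → ℝ} (hu : HasCubicGrowth u) (a : ℝ) :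
    HasCubicGrowth fun t => u (t + a) := by
  obtain ⟨C, hC⟩ := hu
  have hC0 : 0 ≤ C := by simpa using (abs_nonneg _).trans (hC 0)
  refine ⟨C * (1 + |a|) ^ 3, fun t => (hC _).trans ?_⟩
  rw [mul_assoc, ← mul_pow]
  gcongr
  nlinarith [abs_add_le t a, mul_nonneg (abs_nonneg a) (abs_nonneg t)]

theorem HasCubicGrowth.wienerShift {ω : WienerSpace} (hω : HasCubicGrowth ω.1) (s : ℝ) :
    HasCubicGrowth (wienerShift s ω).1 := by
  obtain ⟨C, hC⟩ := hω.comp_add s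
  refine ⟨C + |ω.1 s|, fun t => ?_⟩
  have h1 : (1 : ℝ) ≤ (1 + |t|) ^ 3 := one_le_pow₀ (by simp)
  rw [wienerShift_apply, add_mul]
  refine (abs_sub _ _).trans (add_le_add (hC t) ?_)
  exact le_mul_of_one_le_right (abs_nonneg _) h1

theorem HasCubicGrowth.const_mul {u : ℝ → ℝ} (hu : HasCubicGrowth u) (a : ℝ) :
    HasCubicGrowth fun t => a * u t := by
  obtain ⟨C, hC⟩ := hu
  refine ⟨|a| * C, fun t => ?_⟩
  rw [abs_mul, mul_assoc]
  exact mul_le_mul_of_nonneg_left (hC t) (abs_nonneg a)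

/-- A path with small dyadic increments has cubic growth. -/
theorem hasCubicGrowth_of_dyadic_increments {w : ℝ → ℝ} (hw : Continuous w) (hw0 : w 0 = 0)
    {z : ℝ} (hz : 0 ≤ z)
    (h : ∀ (m : ℕ) (j : ℤ), |w ((j + 1) / 2 ^ m) - w (j / 2 ^ m)| ^ 6 ≤
      z * (1 + (j : ℝ) ^ 2) / 6 ^ m) :
    HasCubicGrowth w := by
  -- integer times
  have hint0 : ∀ j : ℤ, |w (j + 1) - w j| ≤ (1 + z) * (1 + (j : ℝ) ^ 2) := by
    intro j
    have h1 := h 0 j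
    simp only [pow_zero, div_one] at h1
    -- With `1 + z` in place of `z` the right-hand side is at least `1`, so it is below its own
    -- sixth power.
    refine le_of_pow_le_pow_left₀ (n := 6) (by norm_num) (by positivity) (h1.trans ?_)
    have h2 : (1 : ℝ) ≤ (1 + z) * (1 + (j : ℝ) ^ 2) := by nlinarith [sq_nonneg (j : ℝ)]
    refine le_trans ?_ (le_self_pow₀ h2 (by norm_num))
    nlinarith [sq_nonneg (j : ℝ)]
  have hint : ∀ j : ℤ, |w j| ≤ |(j : ℝ)| * ((1 + z) * (1 + (j : ℝ) ^ 2)) := by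
    intro j
    induction j using Int.induction_on with
    | zero => simp [hw0]
    | succ i ih =>
      have h1 := hint0 i
      have hi : (0 : ℝ) ≤ i := Nat.cast_nonneg i
      push_cast at ih h1 ⊢
      rw [abs_of_nonneg hi] at ih
      rw [abs_of_nonneg (by positivity : (0 : ℝ) ≤ i + 1)]
      have h2 : |w (i + 1)| ≤ |w i| + |w (i + 1) - w i| := by
        simpa using abs_add_le (w i) (w (i + 1) - w i)
      have h3 : (1 + z) * (1 + (i : ℝ) ^ 2) ≤ (1 + z) * (1 + ((i : ℝ) + 1) ^ 2) := by
        gcongr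
        linarith
      nlinarith
    | pred i ih =>
      have h1 := hint0 (-i - 1)
      have hi : (0 : ℝ) ≤ i := Nat.cast_nonneg i
      push_cast at ih h1 ⊢
      rw [sub_add_cancel] at h1
      rw [abs_neg, abs_of_nonneg hi] at ih
      rw [show -(i : ℝ) - 1 = -(i + 1) by ring] at h1 ⊢
      rw [abs_neg, abs_of_nonneg (by positivity : (0 : ℝ) ≤ i + 1)]
      rw [neg_sq] at *
      have h2 : |w (-(i + 1))| ≤ |w (-i)| + |w (-i) - w (-(i + 1))| := by
        have := abs_sub (w (-i)) (w (-i) - w (-(i + 1)))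
        simpa using this
      have h3 : (1 + z) * (1 + (i : ℝ) ^ 2) ≤ (1 + z) * (1 + ((i : ℝ) + 1) ^ 2) := by
        gcongr
        linarith
      nlinarith
  -- dyadic approximation
  have hdy : ∀ t : ℝ, |w t - w ⌊t⌋| ≤ (1 + 9 * z) * (1 + t ^ 2) / (1 - 47 / 50) := by
    intro t
    set d : ℕ → ℝ := fun m => ⌊t * 2 ^ m⌋ / 2 ^ m with hd
    have hdt : Tendsto d atTop (𝓝 t) := by
      have h1 : Tendsto (fun m : ℕ => ((1 : ℝ) / 2) ^ m) atTop (𝓝 0) :=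
        tendsto_pow_atTop_nhds_zero_of_lt_one (by norm_num) (by norm_num)
      refine tendsto_iff_dist_tendsto_zero.2 (squeeze_zero (fun _ => dist_nonneg) (fun m => ?_) h1)
      have hp : (0 : ℝ) < 2 ^ m := by positivity
      have h2 : d m - t = -(Int.fract (t * 2 ^ m)) / 2 ^ m := by
        rw [Int.fract, hd]
        field_simp
        ring
      rw [Real.dist_eq, h2, abs_div, abs_neg, abs_of_pos hp, one_div, inv_pow, ← one_div,
        abs_of_nonneg (Int.fract_nonneg _)]
      gcongr
      exact (Int.fract_lt_one _).le
    -- Consecutive dyadic approximations coincide or are neighbours at level `m + 1`. The index has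
    -- square of order `(1 + t²) 4 ^ m`, so the sixth power of the step decays like `(4 / 6) ^ m`;
    -- `47 / 50` is a rational number above the sixth root of `2 / 3`.
    have hstep : ∀ m, dist (w (d m)) (w (d (m + 1))) ≤
        (1 + 9 * z) * (1 + t ^ 2) * (47 / 50) ^ m := by
      intro m
      set k : ℤ := ⌊t * 2 ^ m⌋ with hk
      have hk1 := Int.floor_le (t * 2 ^ m)
      have hk2 := Int.lt_floor_add_one (t * 2 ^ m)
      rw [← hk] at hk1 hk2
      have hp : (0 : ℝ) < 2 ^ m := by positivity
      have hdm : d m = ((2 * k : ℤ) : ℝ) / 2 ^ (m + 1) := by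
        simp only [hd, ← hk]
        push_cast
        rw [pow_succ]
        field_simp
      have hcase : ⌊t * 2 ^ (m + 1)⌋ = 2 * k ∨ ⌊t * 2 ^ (m + 1)⌋ = 2 * k + 1 := by
        have h1 : 2 * k ≤ ⌊t * 2 ^ (m + 1)⌋ := by
          rw [Int.le_floor]; push_cast; rw [pow_succ]; linarith
        have h2 : ⌊t * 2 ^ (m + 1)⌋ < 2 * k + 2 := by
          rw [Int.floor_lt]; push_cast; rw [pow_succ]; linarith
        omega
      rcases hcase with hc | hc
      · have : d (m + 1) = d m := by rw [hdm, hd]; simp only [hc]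
        rw [this, dist_self]
        positivity
      · have hd1 : d (m + 1) = (((2 * k : ℤ) : ℝ) + 1) / 2 ^ (m + 1) := by
          simp only [hd, hc]; push_cast; rfl
        rw [hdm, hd1, dist_comm, Real.dist_eq]
        refine le_of_pow_le_pow_left₀ (n := 6) (by norm_num) (by positivity)
          ((h (m + 1) (2 * k)).trans ?_)
        have hksq : (k : ℝ) ^ 2 ≤ 2 * (t ^ 2 * 4 ^ m) + 2 := by
          have h4 : (4 : ℝ) ^ m = 2 ^ m * 2 ^ m := by rw [← mul_pow]; norm_num
          have h5 : (k : ℝ) = t * 2 ^ m + (k - t * 2 ^ m) := by ring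
          rw [h4]
          nlinarith [sq_nonneg (t * 2 ^ m - (k - t * 2 ^ m))]
        have h4m : (1 : ℝ) ≤ 4 ^ m := one_le_pow₀ (by norm_num)
        have h6 : 1 + (((2 * k : ℤ) : ℝ)) ^ 2 ≤ 9 * (1 + t ^ 2) * 4 ^ m := by
          push_cast
          nlinarith [mul_nonneg (sq_nonneg t) (by positivity : (0 : ℝ) ≤ 4 ^ m)]
        have h7 : z * (1 + (((2 * k : ℤ) : ℝ)) ^ 2) / 6 ^ (m + 1) ≤
            9 * z * (1 + t ^ 2) * (2 / 3) ^ m := by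
          have h23 : ((2 : ℝ) / 3) ^ m = 4 ^ m / 6 ^ m := by rw [← div_pow]; norm_num
          rw [h23, pow_succ (6 : ℝ) m, div_le_iff₀ (by positivity)]
          have h8 : 9 * z * (1 + t ^ 2) * (4 ^ m / 6 ^ m) * (6 ^ m * 6) =
              54 * (z * ((1 + t ^ 2) * 4 ^ m)) := by
            field_simp
            ring
          rw [h8]
          have := mul_le_mul_of_nonneg_left h6 hz
          have h9 : 0 ≤ z * ((1 + t ^ 2) * 4 ^ m) := by positivity
          nlinarith
        refine h7.trans ?_
        rw [mul_pow, ← pow_mul, mul_comm m 6, pow_mul]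
        refine mul_le_mul ?_ ?_ (by positivity) (by positivity)
        · have h10 : 1 ≤ (1 + 9 * z) * (1 + t ^ 2) := by nlinarith [sq_nonneg t]
          refine le_trans ?_ (le_self_pow₀ h10 (by norm_num))
          nlinarith [sq_nonneg t]
        · gcongr
          norm_num
    have h1 := dist_le_of_le_geometric_of_tendsto₀ (47 / 50) ((1 + 9 * z) * (1 + t ^ 2))
      (by norm_num) hstep ((hw.tendsto t).comp hdt)
    simp only [hd, pow_zero, mul_one, div_one] at h1
    rwa [dist_comm, Real.dist_eq] at h1
  refine ⟨17 * (1 + 9 * z) + 3 * (1 + z), fun t => ?_⟩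
  have hfl : |(⌊t⌋ : ℝ)| ≤ 1 + |t| := by
    rw [abs_le]
    have h1 := Int.floor_le t
    have h2 := Int.lt_floor_add_one t
    constructor <;> cases abs_cases t <;> linarith
  have h1 : |w t| ≤ |w ⌊t⌋| + |w t - w ⌊t⌋| := by
    simpa using abs_add_le (w ⌊t⌋) (w t - w ⌊t⌋)
  set a := 1 + |t| with ha
  have ha1 : 1 ≤ a := by simp [ha]
  have ht2 : 1 + t ^ 2 ≤ a ^ 3 := by
    have : t ^ 2 = (a - 1) ^ 2 := by rw [ha, add_sub_cancel_left, sq_abs]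
    nlinarith [mul_nonneg (by linarith : (0 : ℝ) ≤ a) (sq_nonneg (a - 1))]
  have h2 : |(⌊t⌋ : ℝ)| * ((1 + z) * (1 + (⌊t⌋ : ℝ) ^ 2)) ≤ 3 * (1 + z) * a ^ 3 := by
    rw [← sq_abs (⌊t⌋ : ℝ)]
    have h3 : |(⌊t⌋ : ℝ)| ^ 2 ≤ a ^ 2 := by gcongr
    calc |(⌊t⌋ : ℝ)| * ((1 + z) * (1 + |(⌊t⌋ : ℝ)| ^ 2))
        ≤ a * ((1 + z) * (a ^ 2 + a ^ 2)) := by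
          gcongr
          nlinarith
      _ = 2 * (1 + z) * a ^ 3 := by ring
      _ ≤ 3 * (1 + z) * a ^ 3 := by gcongr; norm_num
  have h3 := hdy t
  have h4 : (1 + 9 * z) * (1 + t ^ 2) / (1 - 47 / 50) ≤ 17 * (1 + 9 * z) * a ^ 3 := by
    rw [div_le_iff₀ (by norm_num)]
    have : (1 + 9 * z) * (1 + t ^ 2) ≤ (1 + 9 * z) * a ^ 3 := by gcongr
    have h5 : 0 ≤ (1 + 9 * z) * a ^ 3 := by positivity
    nlinarith
  linarith [hint ⌊t⌋]

/-- Scaling a standard Gaussian by `√v`; the value of its moment is never needed, only its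
finiteness. -/
theorem lintegral_enorm_pow_gaussianReal (v : NNReal) (n : ℕ) :
    ∫⁻ x, ‖x‖ₑ ^ (2 * n) ∂gaussianReal 0 v =
      (v : ENNReal) ^ n * ∫⁻ x, ‖x‖ₑ ^ (2 * n) ∂gaussianReal 0 1 := by
  have h : gaussianReal 0 v = (gaussianReal 0 1).map (fun x => √(v : ℝ) * x) := by
    rw [gaussianReal_map_const_mul, mul_zero, mul_one]
    congr 1
    ext
    simp
  rw [h, lintegral_map (by fun_prop) (by fun_prop)]
  simp only [enorm_mul, mul_pow]
  rw [lintegral_const_mul _ (by fun_prop)]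
  congr 1
  rw [pow_mul]
  congr 1
  rw [Real.enorm_of_nonneg (Real.sqrt_nonneg _), ← ENNReal.ofReal_pow (Real.sqrt_nonneg _),
    Real.sq_sqrt v.coe_nonneg, ENNReal.ofReal_coe_nnreal]

theorem lintegral_enorm_pow_gaussianReal_lt_top {n : ℕ} (hn : n ≠ 0) :
    ∫⁻ x, ‖x‖ₑ ^ n ∂gaussianReal 0 1 < ⊤ := by
  have h := (memLp_id_gaussianReal (μ := 0) (v := 1) n).eLpNorm_lt_top
  rw [eLpNorm_lt_top_iff_lintegral_rpow_enorm_lt_top (by simpa using hn) (by simp)] at h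
  simpa using h

theorem IsWienerMeasure.lintegral_enorm_sub_pow {P : Measure WienerSpace} (hP : IsWienerMeasure P)
    {s t : ℝ} (hst : s ≤ t) (n : ℕ) :
    ∫⁻ ω, ‖ω.1 t - ω.1 s‖ₑ ^ (2 * n) ∂P =
      ENNReal.ofReal (t - s) ^ n * ∫⁻ x, ‖x‖ₑ ^ (2 * n) ∂gaussianReal 0 1 := by
  rw [ENNReal.ofReal, ← lintegral_enorm_pow_gaussianReal, ← hP.gaussian s t hst,
    lintegral_map (by fun_prop) (measurable_wienerSpace_sub s t)]

theorem summable_one_div_one_add_int_sq : Summable fun j : ℤ => 1 / (1 + (j : ℝ) ^ 2) := by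
  refine Summable.of_norm_bounded_eventually (Real.summable_one_div_int_pow.2 one_lt_two) ?_
  filter_upwards [(finite_singleton (0 : ℤ)).compl_mem_cofinite] with j hj
  have hj0 : (0 : ℝ) < (j : ℝ) ^ 2 := by
    have : (j : ℝ) ≠ 0 := by exact_mod_cast hj
    positivity
  rw [Real.norm_of_nonneg (by positivity)]
  exact one_div_le_one_div_of_le hj0 (by linarith)

theorem summable_pow_mul_one_div_one_add_int_sq :
    Summable fun q : ℕ × ℤ => ((6 : ℝ) / 8) ^ q.1 * (1 / (1 + (q.2 : ℝ) ^ 2)) := by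
  have h1 : Summable fun m : ℕ => ((6 : ℝ) / 8) ^ m :=
    summable_geometric_of_lt_one (by norm_num) (by norm_num)
  have h2 : ∀ m : ℕ, 0 ≤ ((6 : ℝ) / 8) ^ m := fun m => by positivity
  have h3 : ∀ j : ℤ, 0 ≤ 1 / (1 + (j : ℝ) ^ 2) := fun j => by positivity
  exact h1.mul_of_nonneg summable_one_div_one_add_int_sq h2 h3

/-- Increments at level `m` have sixth moment of order `8 ^ (-m)`, so the sum `Z` of their sixth
powers with weights `6 ^ m / (1 + j²)` has finite mean and is finite almost surely; `Z` then bounds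
each term. The base `6` lies strictly between `4`, which the chaining must beat, and `8`, which the
moments allow. -/
theorem IsWienerMeasure.ae_hasCubicGrowth {P : Measure WienerSpace} (hP : IsWienerMeasure P) :
    ∀ᵐ ω ∂P, HasCubicGrowth (ω : WienerSpace).1 := by
  set a : ℕ × ℤ → ℝ := fun q => 6 ^ q.1 * (1 / (1 + (q.2 : ℝ) ^ 2)) with ha
  have ha0 : ∀ q, 0 < a q := fun q => by positivity
  set D : ℕ × ℤ → WienerSpace → ℝ := fun q ω =>
    ω.1 ((q.2 + 1) / 2 ^ q.1) - ω.1 (q.2 / 2 ^ q.1) with hD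
  have hDm : ∀ q, Measurable (D q) := fun q => measurable_wienerSpace_sub _ _
  set M := ∫⁻ x, ‖x‖ₑ ^ (2 * 3) ∂gaussianReal 0 1 with hM
  have hMtop : M ≠ ⊤ := (lintegral_enorm_pow_gaussianReal_lt_top (by norm_num)).ne
  set Z : WienerSpace → ENNReal := fun ω => ∑' q, ENNReal.ofReal (a q) * ‖D q ω‖ₑ ^ (2 * 3)
    with hZ
  have hterm : ∀ q, Measurable fun ω => ENNReal.ofReal (a q) * ‖D q ω‖ₑ ^ (2 * 3) := fun q =>
    ((hDm q).enorm.pow_const _).const_mul _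
  have hZm : Measurable Z := Measurable.tsum hterm
  have hZint : ∫⁻ ω, Z ω ∂P ≠ ⊤ := by
    rw [lintegral_tsum fun q => (hterm q).aemeasurable]
    have h1 : ∀ q : ℕ × ℤ, ∫⁻ ω, ENNReal.ofReal (a q) * ‖D q ω‖ₑ ^ (2 * 3) ∂P =
        ENNReal.ofReal ((6 / 8) ^ q.1 * (1 / (1 + (q.2 : ℝ) ^ 2))) * M := by
      intro q
      have hle : (q.2 : ℝ) / 2 ^ q.1 ≤ (q.2 + 1) / 2 ^ q.1 := by gcongr; linarith
      have h8 : (8 : ℝ) ^ q.1 = (2 ^ q.1) ^ 3 := by rw [← pow_mul, mul_comm, pow_mul]; norm_num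
      have heq : a q * (((q.2 : ℝ) + 1) / 2 ^ q.1 - q.2 / 2 ^ q.1) ^ 3 =
          (6 / 8) ^ q.1 * (1 / (1 + (q.2 : ℝ) ^ 2)) := by
        rw [← sub_div, add_sub_cancel_left, div_pow, div_pow, h8]
        simp only [ha]
        ring
      rw [lintegral_const_mul _ ((hDm q).enorm.pow_const _)]
      simp only [hD]
      rw [hP.lintegral_enorm_sub_pow hle 3, ← mul_assoc, ← ENNReal.ofReal_pow (sub_nonneg.2 hle),
        ← ENNReal.ofReal_mul (ha0 q).le, heq]
    simp_rw [h1]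
    rw [ENNReal.tsum_mul_right]
    refine ENNReal.mul_ne_top (Summable.tsum_ofReal_ne_top ?_) hMtop
    exact summable_pow_mul_one_div_one_add_int_sq
  filter_upwards [ae_lt_top hZm hZint] with ω hω
  refine hasCubicGrowth_of_dyadic_increments ω.1.continuous ω.2 (z := (Z ω).toReal)
    ENNReal.toReal_nonneg fun m j => ?_
  have h1 : ENNReal.ofReal (a (m, j)) * ‖D (m, j) ω‖ₑ ^ (2 * 3) ≤ Z ω :=
    ENNReal.le_tsum (f := fun q => ENNReal.ofReal (a q) * ‖D q ω‖ₑ ^ (2 * 3)) (m, j)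
  rw [← ofReal_norm, ← ENNReal.ofReal_pow (norm_nonneg _),
    ← ENNReal.ofReal_mul (ha0 _).le, ENNReal.ofReal_le_iff_le_toReal hω.ne] at h1
  simp only [ha, hD, Real.norm_eq_abs] at h1
  rw [le_div_iff₀ (by positivity), ← div_le_iff₀ (by positivity)]
  calc _ = _ := by ring
    _ ≤ _ := h1

section Attractor

variable {f : ℝ → ℝ → ℝ} (hf : ContDiff ℝ 1 (fun p : ℝ × ℝ => f p.1 p.2)) (σ : ℝ)

/-! ### The nonautonomous random dynamical system -/

include hf in
theorem mem_sdeCocycle_neg_iff {s τ : ℝ} {ω : WienerSpace} {x y : ℝ} :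
    x ∈ sdeCocycle f σ (-s) (τ + s) (wienerShift s ω) y ↔ y ∈ sdeCocycle f σ s τ ω x := by
  have key : ∀ {s τ : ℝ} {ω : WienerSpace} {x y : ℝ}, y ∈ sdeCocycle f σ s τ ω x →
      x ∈ sdeCocycle f σ (-s) (τ + s) (wienerShift s ω) y := by
    intro s τ ω x y h
    rw [← sdeCocycle_add hf σ h, neg_add_cancel]
    exact mem_sdeCocycle_zero hf σ τ ω x
  refine ⟨fun h => ?_, key⟩
  have := key h
  rwa [neg_neg, add_neg_cancel_right, ← wienerShift_add, neg_add_cancel, wienerShift_zero] at this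

include hf in
theorem exists_continuous_mem_sdeCocycle (hdiss : IsDissipative f) {t : ℝ} (ht : 0 ≤ t) (τ : ℝ)
    (ω : WienerSpace) : ∃ ψ : ℝ → ℝ, Continuous ψ ∧ ∀ x, ψ x ∈ sdeCocycle f σ t τ ω x := by
  choose ψ hψ using exists_mem_sdeCocycle_of_nonneg hf σ hdiss ht τ ω
  refine ⟨ψ, continuous_def.2 fun U hU => ?_, hψ⟩
  have := (isOpen_setOf_mem_preimage_sdeCocycle hf σ hU).preimage
    (by fun_prop : Continuous fun x : ℝ => (t, τ, ω, x))
  convert this using 1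
  ext x
  simp only [mem_preimage, mem_ofPred_eq, PFun.mem_preimage]
  exact ⟨fun h => ⟨ψ x, h, hψ x⟩, fun ⟨y, hy, hyx⟩ => Part.mem_unique hyx (hψ x) ▸ hy⟩

include hf in
theorem isNRDS_sdeCocycle (hdiss : IsDissipative f) {P : Measure WienerSpace}
    (hP : IsWienerMeasure P) : IsNRDS P wienerShift (sdeCocycle f σ) where
  base := hP.isMetricDS
  forward t τ ω ht := by
    refine eq_univ_of_forall fun x => ?_
    obtain ⟨y, hy⟩ := exists_mem_sdeCocycle_of_nonneg hf σ hdiss ht τ ω x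
    exact (PFun.mem_dom _ _).2 ⟨y, hy⟩
  measurable B hB := by
    rw [setOf_mem_preimage_sdeCocycle hf]
    exact MeasurableSet.iUnion fun R => (isOpen_setOf_inBox hf σ R).measurableSet.inter
      ((continuous_truncSolution hf σ R).measurable hB)
  zero := Eventually.of_forall fun ω τ x =>
    Part.eq_some_iff.2 (mem_sdeCocycle_zero hf σ τ ω x)
  cocycle := Eventually.of_forall fun ω t s τ x y hy => sdeCocycle_add hf σ hy
  continuous := Eventually.of_forall fun ω U hU =>
    (isOpen_setOf_mem_preimage_sdeCocycle hf σ hU).preimage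
      (by fun_prop : Continuous fun p : ℝ × ℝ × ℝ => (p.1, p.2.1, ω, p.2.2))

/-! ### Pullback absorbing sets -/

/-- The energy that is put into the system up to the elapsed time `s`. -/
noncomputable def energyTail (f : ℝ → ℝ → ℝ) (σ L₁ L₂ c s : ℝ) (τ : ℝ) (ω : WienerSpace) : ℝ :=
  ∫ r in Iic s, Real.exp (c * r) * energyForcing f σ L₁ L₂ τ ω r

/-- The states whose trajectory is at the elapsed time `s` in the absorbing ball. -/
def pullbackImage (f : ℝ → ℝ → ℝ) (σ L₁ L₂ c s : ℝ) (τ : ℝ) (ω : WienerSpace) : Set ℝ :=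
  {z | ∃ w ∈ sdeCocycle f σ s τ ω z, Real.exp (c * s) * (w - σ * ω.1 s) ^ 2 ≤
    energyTail f σ L₁ L₂ c s τ ω + Real.exp (c * s)}

variable {L₁ L₂ c : ℝ}

theorem energyTail_nonneg (hL₁ : 0 ≤ L₁) (hL₂ : 0 < L₂) (s τ : ℝ) (ω : WienerSpace) :
    0 ≤ energyTail f σ L₁ L₂ c s τ ω :=
  integral_nonneg fun r => mul_nonneg (Real.exp_pos _).le (energyForcing_nonneg σ hL₁ hL₂ τ ω r)

include hf in
theorem measurable_energyTail (L₁ L₂ c s : ℝ) :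
    Measurable fun p : ℝ × WienerSpace => energyTail f σ L₁ L₂ c s p.1 p.2 := by
  have h : Continuous fun p : (ℝ × WienerSpace) × ℝ =>
      Real.exp (c * p.2) * energyForcing f σ L₁ L₂ p.1.1 p.1.2 p.2 :=
    (by fun_prop : Continuous fun p : (ℝ × WienerSpace) × ℝ => Real.exp (c * p.2)).mul
      (continuous_energyForcing hf σ L₁ L₂)
  exact (StronglyMeasurable.integral_prod_right (ν := volume.restrict (Iic s))
    (f := fun (p : ℝ × WienerSpace) r => Real.exp (c * r) * energyForcing f σ L₁ L₂ p.1 p.2 r)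
    h.stronglyMeasurable).measurable

include hf in
theorem measurableSet_setOf_mem_pullbackImage (L₁ L₂ c s : ℝ) :
    MeasurableSet {p : ℝ × WienerSpace × ℝ | p.2.2 ∈ pullbackImage f σ L₁ L₂ c s p.1 p.2.1} := by
  have heq : {p : ℝ × WienerSpace × ℝ | p.2.2 ∈ pullbackImage f σ L₁ L₂ c s p.1 p.2.1} =
      ⋃ R : ℕ, {p | InBox hf σ R p.1 p.2.1 p.2.2 s} ∩
        {p | Real.exp (c * s) * (truncSolution hf σ R p.1 p.2.1 p.2.2 s - σ * p.2.1.1 s) ^ 2 ≤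
          energyTail f σ L₁ L₂ c s p.1 p.2.1 + Real.exp (c * s)} := by
    ext p
    simp only [pullbackImage, mem_sdeCocycle_iff hf σ, mem_ofPred_eq, mem_iUnion, mem_inter_iff]
    constructor
    · rintro ⟨_, ⟨R, hR, rfl⟩, h⟩
      exact ⟨R, hR, h⟩
    · rintro ⟨R, hR, h⟩
      exact ⟨_, ⟨R, hR, rfl⟩, h⟩
  rw [heq]
  have hc : Continuous fun p : ℝ × WienerSpace × ℝ => (s, p) := by fun_prop
  refine MeasurableSet.iUnion fun R =>
    ((isOpen_setOf_inBox hf σ R).preimage hc).measurableSet.inter (measurableSet_le ?_ ?_)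
  · have h1 : Measurable fun p : ℝ × WienerSpace × ℝ => truncSolution hf σ R p.1 p.2.1 p.2.2 s :=
      ((continuous_truncSolution hf σ R).comp hc).measurable
    have h2 : Measurable fun p : ℝ × WienerSpace × ℝ => p.2.1.1 s :=
      (measurable_wienerSpace_apply s).comp (measurable_fst.comp measurable_snd)
    exact ((h1.sub (h2.const_mul σ)).pow_const 2).const_mul _
  · exact ((measurable_energyTail hf σ L₁ L₂ c s).comp
      (measurable_fst.prodMk (measurable_fst.comp measurable_snd))).add_const _

include hf in
-- Running back from `z` to the elapsed time `s` inverts the flow that starts at `s`, so a condition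
-- on a partial backward map becomes the image under a total map `ψ`.
theorem pullbackImage_eq_image {s : ℝ} {τ : ℝ} {ω : WienerSpace} {ψ : ℝ → ℝ}
    (hψ : ∀ x, ψ x ∈ sdeCocycle f σ (-s) (τ + s) (wienerShift s ω) x) :
    pullbackImage f σ L₁ L₂ c s τ ω = ψ '' {w | Real.exp (c * s) * (w - σ * ω.1 s) ^ 2 ≤
      energyTail f σ L₁ L₂ c s τ ω + Real.exp (c * s)} := by
  ext z
  constructor
  · rintro ⟨w, hw, h⟩
    exact ⟨w, h, Part.mem_unique (hψ w) ((mem_sdeCocycle_neg_iff hf σ).2 hw)⟩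
  · rintro ⟨w, h, rfl⟩
    exact ⟨w, (mem_sdeCocycle_neg_iff hf σ).1 (hψ w), h⟩

include hf in
-- A continuous image of a closed bounded set. It holds for every `ω`: where the energy integral
-- diverges, its default value `0` still gives a bounded set.
theorem isCompact_pullbackImage (hdiss : IsDissipative f) (L₁ L₂ c : ℝ) {s : ℝ} (hs : s ≤ 0)
    (τ : ℝ) (ω : WienerSpace) : IsCompact (pullbackImage f σ L₁ L₂ c s τ ω) := by
  obtain ⟨ψ, hψc, hψ⟩ := exists_continuous_mem_sdeCocycle hf σ hdiss (neg_nonneg.2 hs) (τ + s)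
    (wienerShift s ω)
  rw [pullbackImage_eq_image hf σ hψ]
  refine IsCompact.image ?_ hψc
  set B := energyTail f σ L₁ L₂ c s τ ω + Real.exp (c * s)
  refine (isCompact_closedBall (σ * ω.1 s) √(B / Real.exp (c * s))).of_isClosed_subset
    (isClosed_le (by fun_prop) continuous_const) fun w hw => ?_
  rw [Metric.mem_closedBall, Real.dist_eq]
  refine Real.abs_le_sqrt ?_
  rw [le_div_iff₀ (Real.exp_pos _), mul_comm]
  exact hw

theorem energyTail_add_integral {τ : ℝ} {ω : WienerSpace}
    (hint : ∀ s, IntegrableOn (fun r => Real.exp (c * r) * energyForcing f σ L₁ L₂ τ ω r) (Iic s))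
    (a b : ℝ) :
    energyTail f σ L₁ L₂ c a τ ω +
      ∫ r in a..b, Real.exp (c * r) * energyForcing f σ L₁ L₂ τ ω r =
    energyTail f σ L₁ L₂ c b τ ω := by
  rw [← intervalIntegral.integral_Iic_sub_Iic (hint a) (hint b), energyTail, energyTail]
  ring

theorem tendsto_energyTail_atBot {τ : ℝ} {ω : WienerSpace}
    (hint : ∀ s, IntegrableOn (fun r => Real.exp (c * r) * energyForcing f σ L₁ L₂ τ ω r)
      (Iic s)) :
    Tendsto (fun s => energyTail f σ L₁ L₂ c s τ ω) atBot (𝓝 0) := by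
  have h := (intervalIntegral_tendsto_integral_Iic 0 (hint 0) tendsto_id).const_sub
    (energyTail f σ L₁ L₂ c 0 τ ω)
  rw [energyTail, sub_self] at h
  refine h.congr fun s => ?_
  have := energyTail_add_integral σ hint s 0
  simp only [energyTail, id] at this ⊢
  linarith

include hf in
/-- Trajectories that are small at the elapsed time `a` are absorbed at the elapsed time `b`. -/
theorem mem_pullbackImage_of_le (hL₂ : 0 < L₂)
    (hdiss : ∀ t x₁ x₂ : ℝ, (x₁ - x₂) * (f t x₁ - f t x₂) ≤ L₁ - L₂ * |x₁ - x₂| ^ 2)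
    (hc : c ≤ L₂) {τ : ℝ} {ω : WienerSpace}
    (hint : ∀ s, IntegrableOn (fun r => Real.exp (c * r) * energyForcing f σ L₁ L₂ τ ω r) (Iic s))
    {a b z w : ℝ} (hab : a ≤ b) (hb : b ≤ 0) (hw : w ∈ sdeCocycle f σ a τ ω z)
    (h : Real.exp (c * a) * (w - σ * ω.1 a) ^ 2 ≤
      energyTail f σ L₁ L₂ c a τ ω + Real.exp (c * b)) :
    z ∈ pullbackImage f σ L₁ L₂ c b τ ω := by
  obtain ⟨v, hv⟩ := exists_mem_sdeCocycle_of_mem_uIcc hf σ hw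
    (mem_uIcc.2 (Or.inr ⟨hab, hb⟩))
  refine ⟨v, hv, (sdeCocycle_energy_le hf σ hL₂ hdiss hc hab hw hv).trans ?_⟩
  linarith [energyTail_add_integral σ hint a b]

include hf in
theorem pullbackImage_mono (hL₂ : 0 < L₂)
    (hdiss : ∀ t x₁ x₂ : ℝ, (x₁ - x₂) * (f t x₁ - f t x₂) ≤ L₁ - L₂ * |x₁ - x₂| ^ 2)
    (hc₀ : 0 < c) (hc : c ≤ L₂) {τ : ℝ} {ω : WienerSpace}
    (hint : ∀ s, IntegrableOn (fun r => Real.exp (c * r) * energyForcing f σ L₁ L₂ τ ω r) (Iic s))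
    {a b : ℝ} (hab : a ≤ b) (hb : b ≤ 0) :
    pullbackImage f σ L₁ L₂ c a τ ω ⊆ pullbackImage f σ L₁ L₂ c b τ ω := by
  rintro z ⟨w, hw, h⟩
  refine mem_pullbackImage_of_le hf σ hL₂ hdiss hc hint hab hb hw (h.trans ?_)
  -- The slack `exp (c * s)` in the absorbing condition increases with `s`, so the nesting survives
  -- it.
  gcongr

/-! ### The attractor -/

/-- The fiber of the attractor. -/
def attractorFiber (f : ℝ → ℝ → ℝ) (σ L₁ L₂ c : ℝ) (τ : ℝ) (ω : WienerSpace) : Set ℝ :=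
  ⋂ n : ℕ, pullbackImage f σ L₁ L₂ c (-n) τ ω

theorem isCompact_attractorFiber (hf : ContDiff ℝ 1 (fun p : ℝ × ℝ => f p.1 p.2))
    (hdiss : IsDissipative f) (L₁ L₂ c τ : ℝ) (ω : WienerSpace) :
    IsCompact (attractorFiber f σ L₁ L₂ c τ ω) := by
  have h : ∀ n : ℕ, IsCompact (pullbackImage f σ L₁ L₂ c (-n) τ ω) := fun n =>
    isCompact_pullbackImage hf σ hdiss L₁ L₂ c (by simp) τ ω
  exact (h 0).of_isClosed_subset (isClosed_iInter fun n => (h n).isClosed) (iInter_subset _ 0)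

theorem HasCubicGrowth.tendsto_exp_mul_sq {u : ℝ → ℝ} (hu : HasCubicGrowth u) (hc : 0 < c) :
    Tendsto (fun h => Real.exp (c * h) * u h ^ 2) atBot (𝓝 0) := by
  have h1 := ((hu.hasSubexponentialGrowth (c / 2) (by positivity)).mono_left le_sup_left).pow 2
  rw [zero_pow two_ne_zero] at h1
  refine h1.congr' ?_
  filter_upwards [eventually_le_atBot 0] with h hh
  rw [abs_of_nonpos hh, mul_pow, ← Real.exp_nat_mul, mul_comm]
  congr 2
  push_cast
  ring

theorem tendsto_exp_mul_add_sq {u v : ℝ → ℝ}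
    (hu : Tendsto (fun h => Real.exp (c * h) * u h ^ 2) atBot (𝓝 0))
    (hv : Tendsto (fun h => Real.exp (c * h) * v h ^ 2) atBot (𝓝 0)) :
    Tendsto (fun h => Real.exp (c * h) * (u h + v h) ^ 2) atBot (𝓝 0) := by
  have h := (hu.const_mul 2).add (hv.const_mul 2)
  rw [mul_zero, add_zero] at h
  refine squeeze_zero (fun h => by positivity) (fun h => ?_) h
  nlinarith [mul_nonneg (Real.exp_pos (c * h)).le (sq_nonneg (u h - v h))]

theorem tendsto_exp_mul_atBot (hc : 0 < c) : Tendsto (fun h => Real.exp (c * h)) atBot (𝓝 0) :=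
  Real.tendsto_exp_atBot.comp (tendsto_id.const_mul_atBot hc)

include hf in
/-- The fibers of the attractor consist of the values of the tempered entire trajectories. -/
theorem mem_attractorFiber_iff (hdiss' : IsDissipative f) (hL₁ : 0 ≤ L₁) (hL₂ : 0 < L₂)
    (hdiss : ∀ t x₁ x₂ : ℝ, (x₁ - x₂) * (f t x₁ - f t x₂) ≤ L₁ - L₂ * |x₁ - x₂| ^ 2)
    (hc₀ : 0 < c) (hc : c ≤ L₂) {τ : ℝ} {ω : WienerSpace} (hω : HasCubicGrowth ω.1)
    (hint : ∀ s, IntegrableOn (fun r => Real.exp (c * r) * energyForcing f σ L₁ L₂ τ ω r) (Iic s))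
    {z : ℝ} :
    z ∈ attractorFiber f σ L₁ L₂ c τ ω ↔ ∃ v : ℝ → ℝ, (∀ h, v h ∈ sdeCocycle f σ h τ ω z) ∧
      Tendsto (fun h => Real.exp (c * h) * v h ^ 2) atBot (𝓝 0) := by
  have hωt := (hω.const_mul σ).tendsto_exp_mul_sq hc₀
  constructor
  · intro hz
    have hz' : ∀ h ≤ 0, z ∈ pullbackImage f σ L₁ L₂ c h τ ω := by
      intro h hh
      obtain ⟨n, hn⟩ := exists_nat_ge (-h)
      exact pullbackImage_mono hf σ hL₂ hdiss hc₀ hc hint (by linarith) hh (mem_iInter.1 hz n)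
    have hex : ∀ h, ∃ y, y ∈ sdeCocycle f σ h τ ω z := by
      intro h
      rcases le_total 0 h with hh | hh
      · exact exists_mem_sdeCocycle_of_nonneg hf σ hdiss' hh τ ω z
      · obtain ⟨w, hw, -⟩ := hz' h hh
        exact ⟨w, hw⟩
    choose v hv using hex
    refine ⟨v, hv, ?_⟩
    have h1 : Tendsto (fun h => Real.exp (c * h) * (v h - σ * ω.1 h) ^ 2) atBot (𝓝 0) := by
      have h2 := (tendsto_energyTail_atBot σ hint).add (tendsto_exp_mul_atBot hc₀)
      rw [add_zero] at h2
      refine squeeze_zero' (Eventually.of_forall fun h => by positivity) ?_ h2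
      filter_upwards [eventually_le_atBot 0] with h hh
      obtain ⟨w, hw, hwle⟩ := hz' h hh
      rwa [Part.mem_unique (hv h) hw]
    simpa using tendsto_exp_mul_add_sq h1 hωt
  · rintro ⟨v, hv, hvt⟩
    refine mem_iInter.2 fun n => ⟨v (-n), hv _, ?_⟩
    have h1 : Tendsto (fun h => Real.exp (c * h) * (v h - σ * ω.1 h) ^ 2) atBot (𝓝 0) := by
      have h2 : Tendsto (fun h => Real.exp (c * h) * (-(σ * ω.1 h)) ^ 2) atBot (𝓝 0) := by
        simpa only [neg_sq] using hωt
      simpa only [sub_eq_add_neg] using tendsto_exp_mul_add_sq hvt h2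
    have h2 := h1.add_const (energyTail f σ L₁ L₂ c (-n) τ ω)
    rw [zero_add] at h2
    -- The energy estimate from `h` to `-n` loses its initial term as `h → -∞`; the tail alone
    -- remains, and the slack is not used.
    refine le_trans (ge_of_tendsto h2 ?_) (le_add_of_nonneg_right (Real.exp_pos _).le)
    filter_upwards [eventually_le_atBot (-n : ℝ)] with h hh
    refine (sdeCocycle_energy_le hf σ hL₂ hdiss hc hh (hv h) (hv (-n))).trans ?_
    have := energyTail_add_integral σ hint h (-n)
    have := energyTail_nonneg (f := f) (c := c) σ hL₁ hL₂ h τ ω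
    linarith

/-- Integrability is assumed in absolute time; it is applied to the translated path `σ * ω (r - τ)`,
and the change of variable costs the factor `exp (-(c * τ))`. -/
theorem integrableOn_exp_mul_energyForcing (L₁ L₂ : ℝ) (hc₀ : 0 < c)
    (hint : ∀ (t : ℝ) (u : ℝ → ℝ), Continuous u → HasSubexponentialGrowth u →
      IntegrableOn (fun r => Real.exp (c * r) * |f r (u r)| ^ 2) (Iic t))
    {ω : WienerSpace} (hω : HasCubicGrowth ω.1) (τ s : ℝ) :
    IntegrableOn (fun r => Real.exp (c * r) * energyForcing f σ L₁ L₂ τ ω r) (Iic s) := by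
  have hu : HasCubicGrowth fun r => σ * ω.1 (r + -τ) := (hω.comp_add (-τ)).const_mul σ
  have h1 := hint (τ + s) _ (by fun_prop) hu.hasSubexponentialGrowth
  rw [← (measurePreserving_add_left volume τ).integrableOn_comp_preimage
    (measurableEmbedding_addLeft τ)] at h1
  have h2 : (fun x => τ + x) ⁻¹' Iic (τ + s) = Iic s := by
    ext x
    simp
  rw [h2] at h1
  have h3 := (integrableOn_exp_mul_Iic hc₀ s).const_mul (2 * L₁)
  have h4 := h1.const_mul (Real.exp (-(c * τ)) / L₂)
  refine IntegrableOn.congr_fun (Integrable.add h3 h4) (fun r _ => ?_) measurableSet_Iic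
  simp only [Pi.add_apply, Function.comp_apply, energyForcing, add_neg_cancel_comm]
  rw [mul_add c, Real.exp_add, Real.exp_neg]
  field_simp

include hf in
theorem exists_isGlobalNRAttractor (hdiss : IsDissipative f) (hint : IsExpIntegrable f)
    {P : Measure WienerSpace} (hP : IsWienerMeasure P) :
    ∃ A : Set (ℝ × WienerSpace × ℝ),
      IsGlobalNRAttractor P wienerShift (sdeCocycle f σ) A := by
  have hdiss' := hdiss
  obtain ⟨L₁, L₂, hL₁, hL₂, hd⟩ := hdiss
  obtain ⟨C₀, hC₀, hint⟩ := hint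
  -- The energy estimate needs `c ≤ L₂`, the integrability of the forcing `c < C₀`.
  obtain ⟨c, hc₀, hcL, hcC⟩ : ∃ c, 0 < c ∧ c ≤ L₂ ∧ c < C₀ :=
    ⟨min L₂ (C₀ / 2), lt_min hL₂ (half_pos hC₀), min_le_left _ _,
      (min_le_right _ _).trans_lt (half_lt_self hC₀)⟩
  have hI : ∀ {ω : WienerSpace}, HasCubicGrowth ω.1 → ∀ τ s : ℝ,
      IntegrableOn (fun r => Real.exp (c * r) * energyForcing f σ L₁ L₂ τ ω r) (Iic s) :=
    fun hω => integrableOn_exp_mul_energyForcing σ L₁ L₂ hc₀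
      (fun t u hu hu' => hint t c hc₀ hcC u hu hu') hω
  refine ⟨{p | p.2.2 ∈ attractorFiber f σ L₁ L₂ c p.1 p.2.1}, ?_, ?_, ?_, ?_⟩
  · have : {p : ℝ × WienerSpace × ℝ | p.2.2 ∈ attractorFiber f σ L₁ L₂ c p.1 p.2.1} =
        ⋂ n : ℕ, {p | p.2.2 ∈ pullbackImage f σ L₁ L₂ c (-n) p.1 p.2.1} := by
      ext p
      simp [attractorFiber]
    rw [this]
    exact MeasurableSet.iInter fun n => measurableSet_setOf_mem_pullbackImage hf σ L₁ L₂ c _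
  · exact fun τ ω => isCompact_attractorFiber σ hf hdiss' L₁ L₂ c τ ω
  · filter_upwards [hP.ae_hasCubicGrowth] with ω₀ hω₀
    -- A time shift of a tempered entire trajectory is again one, its weight changing by `exp (-(c *
    -- t))`. Stated for all paths of cubic growth, so that the reverse inclusion can apply it to the
    -- shifted path with time `-t`.
    have key : ∀ {ω : WienerSpace}, HasCubicGrowth ω.1 → ∀ t τ z : ℝ,
        z ∈ attractorFiber f σ L₁ L₂ c τ ω → ∃ y ∈ sdeCocycle f σ t τ ω z,
          y ∈ attractorFiber f σ L₁ L₂ c (τ + t) (wienerShift t ω) := by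
      intro ω hω t τ z hz
      obtain ⟨v, hv, hvt⟩ := (mem_attractorFiber_iff hf σ hdiss' hL₁ hL₂ hd hc₀ hcL hω
        (hI hω τ)).1 hz
      refine ⟨v t, hv t, (mem_attractorFiber_iff hf σ hdiss' hL₁ hL₂ hd hc₀ hcL
        (hω.wienerShift t) (hI (hω.wienerShift t) _)).2 ⟨fun h => v (h + t), fun h => ?_, ?_⟩⟩
      · rw [← sdeCocycle_add hf σ (hv t)]
        exact hv _
      · have h1 := (hvt.comp (tendsto_atBot_add_const_right atBot t tendsto_id)).const_mul
          (Real.exp (-(c * t)))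
        rw [mul_zero] at h1
        refine h1.congr fun h => ?_
        simp only [Function.comp_apply, id]
        rw [← mul_assoc, ← Real.exp_add]
        congr 2
        ring
    intro t τ
    constructor
    · intro z hz
      obtain ⟨y, hy, -⟩ := key hω₀ t τ z hz
      exact (PFun.mem_dom _ _).2 ⟨y, hy⟩
    · ext y
      rw [PFun.mem_image]
      constructor
      · rintro ⟨z, hz, hyz⟩
        obtain ⟨y', hy', hy'A⟩ := key hω₀ t τ z hz
        rw [Part.mem_unique hyz hy']
        exact hy'A
      · intro hy
        obtain ⟨z, hz, hzA⟩ := key (hω₀.wienerShift t) (-t) (τ + t) y hy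
        rw [add_neg_cancel_right, ← wienerShift_add, neg_add_cancel, wienerShift_zero] at hzA
        exact ⟨z, hzA, (mem_sdeCocycle_neg_iff hf σ).1 hz⟩
  · filter_upwards [hP.ae_hasCubicGrowth] with ω hω τ C hC
    obtain ⟨M, hM⟩ := hC.exists_norm_le
    rw [ENNReal.tendsto_nhds_zero]
    intro ε hε
    have hmono : ∀ {m n : ℕ}, m ≤ n → pullbackImage f σ L₁ L₂ c (-n) τ ω ⊆
        pullbackImage f σ L₁ L₂ c (-m) τ ω := fun hmn =>
      pullbackImage_mono hf σ hL₂ hd hc₀ hcL (hI hω τ) (by simpa using hmn) (by simp)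
    have hcpt : ∀ n : ℕ, IsCompact (pullbackImage f σ L₁ L₂ c (-n) τ ω) := fun n =>
      isCompact_pullbackImage hf σ hdiss' L₁ L₂ c (by simp) τ ω
    set A := attractorFiber f σ L₁ L₂ c τ ω with hA
    have hAopen : IsOpen {z | Metric.infEDist z A < ε} :=
      isOpen_lt Metric.continuous_infEDist continuous_const
    -- A decreasing sequence of compact sets eventually enters any open neighbourhood of its
    -- intersection.
    obtain ⟨n, hn⟩ := exists_subset_nhds_of_isCompact'
      (V := fun n : ℕ => pullbackImage f σ L₁ L₂ c (-n) τ ω)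
      (directed_of_isDirected_le fun m n hmn => hmono hmn) hcpt (fun n => (hcpt n).isClosed)
      (U := {z | Metric.infEDist z A < ε}) (fun z hz => hAopen.mem_nhds (by
        have : Metric.infEDist z A = 0 := Metric.infEDist_zero_of_mem hz
        simpa [this] using hε))
    have hlim : Tendsto (fun h => Real.exp (c * h) * (M + |σ * ω.1 h|) ^ 2) atBot (𝓝 0) := by
      refine tendsto_exp_mul_add_sq (u := fun _ => M) (v := fun h => |σ * ω.1 h|) ?_ ?_
      · simpa using (tendsto_exp_mul_atBot hc₀).mul_const (M ^ 2)
      · simpa only [sq_abs] using (hω.const_mul σ).tendsto_exp_mul_sq hc₀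
    -- Seen from the distant past, the weighted energy of the bounded set falls below `exp (c *
    -- (-n))`, exactly the slack with which trajectories are absorbed at the elapsed time `-n`.
    filter_upwards [(hlim.comp tendsto_neg_atTop_atBot).eventually
      (gt_mem_nhds (Real.exp_pos (c * (-n : ℝ)))), eventually_ge_atTop (n : ℝ)] with t ht htn
    refine iSup₂_le fun z hz => ?_
    obtain ⟨x, hx, hzx⟩ := (PFun.mem_image _ _ _).1 hz
    have hxz : x ∈ sdeCocycle f σ (-t) τ ω z := by
      rw [← mem_sdeCocycle_neg_iff hf σ, neg_neg]
      exact hzx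
    have hzn : z ∈ pullbackImage f σ L₁ L₂ c (-n) τ ω := by
      refine mem_pullbackImage_of_le hf σ hL₂ hd hcL (hI hω τ) (neg_le_neg htn) (by simp) hxz ?_
      have h1 : (x - σ * ω.1 (-t)) ^ 2 ≤ (M + |σ * ω.1 (-t)|) ^ 2 := by
        rw [← sq_abs (x - σ * ω.1 (-t))]
        have h2 : |x - σ * ω.1 (-t)| ≤ M + |σ * ω.1 (-t)| :=
          (abs_sub _ _).trans (add_le_add_left (hM x hx) _)
        gcongr
      have h3 := mul_le_mul_of_nonneg_left h1 (Real.exp_pos (c * -t)).le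
      have h4 := energyTail_nonneg (f := f) (c := c) σ hL₁ hL₂ (-t) τ ω
      simp only [Function.comp_apply] at ht
      linarith
    have := hn hzn
    exact le_of_lt this

end Attractor

theorem mainTheorem5 (f : ℝ → ℝ → ℝ) (hf : ContDiff ℝ 1 (fun p : ℝ × ℝ => f p.1 p.2))
    (σ : ℝ) (hσ : 0 < σ) (hdiss : IsDissipative f) (hint : IsExpIntegrable f)
    (P : Measure WienerSpace) (hP : IsWienerMeasure P) :
    IsNRDS P wienerShift (sdeCocycle f σ) ∧
      ∃ A : Set (ℝ × WienerSpace × ℝ), IsGlobalNRAttractor P wienerShift (sdeCocycle f σ) A := by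
  exact ⟨isNRDS_sdeCocycle hf σ hdiss hP, exists_isGlobalNRAttractor hf σ hdiss hint hP⟩
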